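/- Let $\mathfrak g$ be a finite-dimensional real semisimple Lie algebra with Killing form $B$, let $\theta$ be a Cartan involution of $\mathfrak g$, and give $\mathfrak g$ the inner product $\langle X,Y\rangle=-B(\theta X,Y)$ and $\mathbb R^n$ the standard one. Let $V_n=\Lambda^2(\mathbb R^n)^*\otimes\mathbb R^n\oplus\mathrm{Hom}(\mathbb R^n,\mathfrak g)$ with the induced inner product $\langle(\mu,\phi),(\nu,\psi)\rangle=\sum_{i<j}\langle\mu(e_i,e_j),\nu(e_i,e_j)\rangle+\sum_i\langle\phi e_i,\psi e_i\rangle$, let $L_n(\mathfrak g)\subset V_n$ be the set of pairs $(\mu,\phi)$ with $\mu$ a Lie bracket on $\mathbb R^n$ and $\phi:(\mathbb R^n,\mu)\to\mathfrak g$ a Lie algebra homomorphism, and let $\mathcal L_n(\mathfrak g)\subset\mathbb P(V_n)$ be its projectivization, with points $(\mu:\phi)$. The group $GL(n,\mathbb R)\times\mathrm{Inn}(\mathfrak g)$ acts by $(g,f)\cdot(\mu,\phi)=(g\mu(g^{-1}\cdot,g^{-1}\cdot),\,f\phi g^{-1})$. For $0\ne v\in V_n$ let $m(v)\in\mathfrak{gl}(n,\mathbb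 R)\oplus\mathfrak g$ be the vector with $\langle m(v),\alpha\rangle=\langle\alpha\cdot v,v\rangle/\|v\|^2$ for all $\alpha\in\mathfrak{gl}(n,\mathbb R)\oplus\mathfrak g$, where $\alpha\cdot v$ is the infinitesimal action and $\langle(A,x),(B,y)\rangle=\mathrm{Tr}(A^{T}B)+\langle x,y\rangle$. The energy is the function $E=\|m\|^2$ on $\mathbb P(V_n)$; a pair is critical if it is a critical point of $E$. **Theorem 3.2.** Let $(0:\phi)\in\mathcal L_n(\mathfrak g)$; that is, $\phi:\mathbb R^n\to\mathfrak g$ is a nonzero linear map with $[\phi X,\phi Y]=0$ for all $X,Y$. Then $E(0:\phi)=\tfrac1n$ if and only if $\phi$ is a homothety (there is $c>0$ with $\langle\phi X,\phi Y\rangle=c\langle X,Y\rangle$ for all $X,Y$) and $\operatorname{im}\phi$ is contained in some $\theta$-invariant Cartan subalgebra of $\mathfrak g$. Moreover, the $GL(n,\mathbb R)\times\mathrm{Inn}(\mathfrak g)$-orbit of $(0:\phi)$ contains a critical pair of energy $\tfrac1n$ if and only if $\ker\phi=0$ and $\operatorname{im}\phi$ is toral, i.e. a Lie subalgebra all of whose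 elements $x$ are semisimple ($\operatorname{ad}x$ is a semisimple endomorphism of $\mathfrak g$). -/

import Mathlib

namespace LiePair

/-- Euclidean space `ℝⁿ` with its standard inner product. -/
abbrev Euc (n : ℕ) : Type := EuclideanSpace ℝ (Fin n)

/-- The standard orthonormal basis `e₁, …, eₙ` of `ℝⁿ`. -/
noncomputable abbrev stdBasis (n : ℕ) : OrthonormalBasis (Fin n) ℝ (Euc n) :=
  EuclideanSpace.basisFun (Fin n) ℝ

section CartanInvolution

variable (𝔤 : Type*) [LieRing 𝔤] [LieAlgebra ℝ 𝔤]

/-- A Cartan involution of a real Lie algebra `𝔤`: an involutive automorphism `θ` such that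
`-B(θ X, Y)` is positive definite, where `B` is the Killing form. -/
structure CartanInvolution where
  /-- the underlying automorphism of `𝔤` -/
  toEquiv : 𝔤 ≃ₗ⁅ℝ⁆ 𝔤
  involutive : ∀ x, toEquiv (toEquiv x) = x
  pos : ∀ x, x ≠ 0 → 0 < -(killingForm ℝ 𝔤 (toEquiv x) x)

end CartanInvolution

section

variable {𝔤 : Type*} [LieRing 𝔤] [LieAlgebra ℝ 𝔤]

/-- The inner product `⟨X, Y⟩ = -B(θ X, Y)` on `𝔤`. -/
noncomputable def CartanInvolution.form (θ : CartanInvolution 𝔤) : LinearMap.BilinForm ℝ 𝔤 :=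
  -((killingForm ℝ 𝔤).comp (θ.toEquiv : 𝔤 →ₗ[ℝ] 𝔤) LinearMap.id)

theorem CartanInvolution.form_apply (θ : CartanInvolution 𝔤) (x y : 𝔤) :
    θ.form x y = -(killingForm ℝ 𝔤 (θ.toEquiv x) y) := rfl

/-- The space `Λ²(ℝⁿ)* ⊗ ℝⁿ` of alternating bilinear maps `ℝⁿ × ℝⁿ → ℝⁿ`. -/
def AltBracket (n : ℕ) : Submodule ℝ (Euc n →ₗ[ℝ] Euc n →ₗ[ℝ] Euc n) where
  carrier := {μ | ∀ x, μ x x = 0}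
  add_mem' := by
    intro a b ha hb x
    simp [ha x, hb x]
  zero_mem' := by
    intro x
    simp
  smul_mem' := by
    intro c a ha x
    simp [ha x]

variable (𝔤) in
/-- The representation space `Λ²(ℝⁿ)* ⊗ ℝⁿ ⊕ Hom(ℝⁿ, 𝔤)`. -/
abbrev Rep (n : ℕ) : Type _ := AltBracket n × (Euc n →ₗ[ℝ] 𝔤)

variable (𝔤) in
/-- The variety `L_n(𝔤)` of pairs `(μ, φ)` where `μ` is a Lie bracket on `ℝⁿ` and
`φ : (ℝⁿ, μ) → 𝔤` is a homomorphism of Lie algebras. -/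
def pairVariety (n : ℕ) : Set (Rep 𝔤 n) :=
  {v | (∀ x y z, v.1.1 x (v.1.1 y z) + v.1.1 y (v.1.1 z x) + v.1.1 z (v.1.1 x y) = 0) ∧
    ∀ x y, v.2 (v.1.1 x y) = ⁅v.2 x, v.2 y⁆}

variable (𝔤) in
/-- The projectivization `𝓛_n(𝔤)` of `L_n(𝔤)`, inside the projective space of the
representation space. Its points are written `(μ : φ)`. -/
def projVariety (n : ℕ) : Set (Projectivization ℝ (Rep 𝔤 n)) :=
  {p | ∃ (v : Rep 𝔤 n) (hv : v ≠ 0), v ∈ pairVariety 𝔤 n ∧ Projectivization.mk ℝ v hv = p}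

/-! ### The group `GL(n, ℝ) × Inn(𝔤)` and its action -/

/-- The linear automorphism `exp (ad x)` of `𝔤`, as an endomorphism; the exponential is computed
on matrices with respect to some basis of `𝔤` (the result does not depend on the basis). -/
noncomputable def expAd [FiniteDimensional ℝ 𝔤] (x : 𝔤) : Module.End ℝ 𝔤 :=
  Matrix.toLin (Module.finBasis ℝ 𝔤) (Module.finBasis ℝ 𝔤)
    (NormedSpace.exp (LinearMap.toMatrix (Module.finBasis ℝ 𝔤) (Module.finBasis ℝ 𝔤)
      (LieAlgebra.ad ℝ 𝔤 x)))

variable (𝔤) in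
/-- The group `Inn(𝔤)` of inner automorphisms, generated by the `exp (ad x)`, `x ∈ 𝔤`. -/
def innerGroup [FiniteDimensional ℝ 𝔤] : Subgroup (𝔤 ≃ₗ[ℝ] 𝔤) :=
  Subgroup.closure {f | ∃ x : 𝔤, (f : Module.End ℝ 𝔤) = expAd x}

/-- The bracket `g μ(g⁻¹ x, g⁻¹ y)`. -/
def actBracket {n : ℕ} (g : Euc n ≃ₗ[ℝ] Euc n) (μ : AltBracket n) : AltBracket n :=
  ⟨(μ.1.compl₁₂ (g.symm : Euc n →ₗ[ℝ] Euc n) (g.symm : Euc n →ₗ[ℝ] Euc n)).compr₂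
      (g : Euc n →ₗ[ℝ] Euc n), by
    intro x
    have h : μ.1 (g.symm x) (g.symm x) = 0 := μ.2 _
    simp [h]⟩

theorem actBracket_apply {n : ℕ} (g : Euc n ≃ₗ[ℝ] Euc n) (μ : AltBracket n) (x y : Euc n) :
    (actBracket g μ).1 x y = g (μ.1 (g.symm x) (g.symm y)) := rfl

/-- The action `(g, f) · (μ, φ) = (g μ(g⁻¹ ·, g⁻¹ ·), f φ g⁻¹)`. -/
def act {n : ℕ} (g : Euc n ≃ₗ[ℝ] Euc n) (f : 𝔤 ≃ₗ[ℝ] 𝔤) : Rep 𝔤 n →ₗ[ℝ] Rep 𝔤 n where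
  toFun v := (actBracket g v.1,
    (f : 𝔤 →ₗ[ℝ] 𝔤) ∘ₗ v.2 ∘ₗ (g.symm : Euc n →ₗ[ℝ] Euc n))
  map_add' v w := by
    refine Prod.ext (Subtype.ext ?_) ?_
    · refine LinearMap.ext₂ fun x y => ?_
      change g ((v.1.1 + w.1.1) (g.symm x) (g.symm y)) =
        g (v.1.1 (g.symm x) (g.symm y)) + g (w.1.1 (g.symm x) (g.symm y))
      simp
    · refine LinearMap.ext fun x => ?_
      simp
  map_smul' c v := by
    refine Prod.ext (Subtype.ext ?_) ?_
    · refine LinearMap.ext₂ fun x y => ?_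
      change g ((c • v.1.1) (g.symm x) (g.symm y)) = c • g (v.1.1 (g.symm x) (g.symm y))
      simp
    · refine LinearMap.ext fun x => ?_
      simp

theorem act_injective {n : ℕ} (g : Euc n ≃ₗ[ℝ] Euc n) (f : 𝔤 ≃ₗ[ℝ] 𝔤) :
    Function.Injective (act (n := n) g f) := by
  have h : Function.LeftInverse (act (n := n) g.symm f.symm) (act (n := n) g f) := by
    intro v
    refine Prod.ext (Subtype.ext ?_) ?_
    · refine LinearMap.ext₂ fun x y => ?_
      change g.symm (g (v.1.1 (g.symm (g x)) (g.symm (g y)))) = v.1.1 x y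
      simp
    · refine LinearMap.ext fun x => ?_
      change f.symm (f (v.2 (g.symm (g x)))) = v.2 x
      simp
  exact h.injective

/-- The orbit of a point of projective space under the group `GL(n, ℝ) × Inn(𝔤)`. -/
def orbit [FiniteDimensional ℝ 𝔤] {n : ℕ} (p : Projectivization ℝ (Rep 𝔤 n)) :
    Set (Projectivization ℝ (Rep 𝔤 n)) :=
  {q | ∃ (g : Euc n ≃ₗ[ℝ] Euc n) (f : 𝔤 ≃ₗ[ℝ] 𝔤), f ∈ innerGroup 𝔤 ∧
    q = Projectivization.map (act g f) (act_injective g f) p}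

/-! ### The moment map and the energy -/

/-- The inner product on the representation space induced by those of `ℝⁿ` and `𝔤`:
`⟨(μ, φ), (ν, ψ)⟩ = ∑_{i<j} ⟨μ(eᵢ, eⱼ), ν(eᵢ, eⱼ)⟩ + ∑ᵢ ⟨φ eᵢ, ψ eᵢ⟩`. The first sum is written as
half of the sum over all pairs `(i, j)`. -/
noncomputable def repInner (θ : CartanInvolution 𝔤) {n : ℕ} (v w : Rep 𝔤 n) : ℝ :=
  (1 / 2 : ℝ) * ∑ i, ∑ j, inner ℝ (v.1.1 (stdBasis n i) (stdBasis n j))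
      (w.1.1 (stdBasis n i) (stdBasis n j)) +
    ∑ i, θ.form (v.2 (stdBasis n i)) (w.2 (stdBasis n i))

/-- The differential of `act`: the action
`(A, x) · (μ, φ) = (A μ(·, ·) - μ(A ·, ·) - μ(·, A ·), ad_x φ - φ A)`
of the Lie algebra `𝔤𝔩(n, ℝ) ⊕ 𝔤` of `GL(n, ℝ) × Inn(𝔤)`. -/
def infAct {n : ℕ} (α : Module.End ℝ (Euc n) × 𝔤) (v : Rep 𝔤 n) : Rep 𝔤 n :=
  (⟨v.1.1.compr₂ α.1 - v.1.1.compl₁₂ α.1 LinearMap.id - v.1.1.compl₁₂ LinearMap.id α.1, by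
      intro x
      have h0 : v.1.1 x x = 0 := v.1.2 x
      have h1 : v.1.1 (α.1 x) (α.1 x) = 0 := v.1.2 _
      have h2 : v.1.1 (x + α.1 x) (x + α.1 x) = 0 := v.1.2 _
      simp only [map_add, LinearMap.add_apply, h0, h1, zero_add, add_zero] at h2
      simp only [LinearMap.sub_apply, LinearMap.compr₂_apply, LinearMap.compl₁₂_apply,
        LinearMap.id_apply, h0, map_zero, zero_sub]
      rw [← neg_add', h2, neg_zero]⟩,
    (LieAlgebra.ad ℝ 𝔤 α.2 : 𝔤 →ₗ[ℝ] 𝔤) ∘ₗ v.2 - v.2 ∘ₗ α.1)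

theorem infAct_fst {n : ℕ} (α : Module.End ℝ (Euc n) × 𝔤) (v : Rep 𝔤 n) (x y : Euc n) :
    (infAct α v).1.1 x y = α.1 (v.1.1 x y) - v.1.1 (α.1 x) y - v.1.1 x (α.1 y) := rfl

theorem infAct_snd {n : ℕ} (α : Module.End ℝ (Euc n) × 𝔤) (v : Rep 𝔤 n) (x : Euc n) :
    (infAct α v).2 x = ⁅α.2, v.2 x⁆ - v.2 (α.1 x) := rfl

theorem infAct_add {n : ℕ} (α β : Module.End ℝ (Euc n) × 𝔤) (v : Rep 𝔤 n) :
    infAct (α + β) v = infAct α v + infAct β v := by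
  refine Prod.ext (Subtype.ext (LinearMap.ext₂ fun x y => ?_)) (LinearMap.ext fun x => ?_)
  · change _ = (infAct α v).1.1 x y + (infAct β v).1.1 x y
    simp only [infAct_fst, Prod.fst_add, LinearMap.add_apply, map_add]
    abel
  · change _ = (infAct α v).2 x + (infAct β v).2 x
    simp only [infAct_snd, Prod.fst_add, Prod.snd_add, LinearMap.add_apply, map_add, add_lie]
    abel

theorem infAct_smul {n : ℕ} (c : ℝ) (α : Module.End ℝ (Euc n) × 𝔤) (v : Rep 𝔤 n) :
    infAct (c • α) v = c • infAct α v := by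
  refine Prod.ext (Subtype.ext (LinearMap.ext₂ fun x y => ?_)) (LinearMap.ext fun x => ?_)
  · change _ = c • (infAct α v).1.1 x y
    simp only [infAct_fst, Prod.smul_fst, LinearMap.smul_apply, map_smul, smul_sub]
  · change _ = c • (infAct α v).2 x
    simp only [infAct_snd, Prod.smul_fst, Prod.smul_snd, LinearMap.smul_apply, map_smul, smul_lie,
      smul_sub]

theorem infAct_smul_right {n : ℕ} (c : ℝ) (α : Module.End ℝ (Euc n) × 𝔤) (v : Rep 𝔤 n) :
    infAct α (c • v) = c • infAct α v := by
  refine Prod.ext (Subtype.ext (LinearMap.ext₂ fun x y => ?_)) (LinearMap.ext fun x => ?_)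
  · change α.1 (c • v.1.1 x y) - c • v.1.1 (α.1 x) y - c • v.1.1 x (α.1 y) =
      c • (infAct α v).1.1 x y
    simp only [infAct_fst, map_smul, smul_sub]
  · change ⁅α.2, c • v.2 x⁆ - c • v.2 (α.1 x) = c • (infAct α v).2 x
    simp only [infAct_snd, lie_smul, smul_sub]

theorem repInner_add_left (θ : CartanInvolution 𝔤) {n : ℕ} (v v' w : Rep 𝔤 n) :
    repInner θ (v + v') w = repInner θ v w + repInner θ v' w := by
  simp only [repInner, Prod.fst_add, Prod.snd_add, Submodule.coe_add, LinearMap.add_apply,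
    inner_add_left, map_add, Finset.sum_add_distrib]
  ring

theorem repInner_smul_left (θ : CartanInvolution 𝔤) {n : ℕ} (c : ℝ) (v w : Rep 𝔤 n) :
    repInner θ (c • v) w = c * repInner θ v w := by
  simp only [repInner, Prod.smul_fst, Prod.smul_snd, Submodule.coe_smul, LinearMap.smul_apply,
    real_inner_smul_left, map_smul, smul_eq_mul, ← Finset.mul_sum]
  ring

theorem repInner_smul_right (θ : CartanInvolution 𝔤) {n : ℕ} (c : ℝ) (v w : Rep 𝔤 n) :
    repInner θ v (c • w) = c * repInner θ v w := by
  simp only [repInner, Prod.smul_fst, Prod.smul_snd, Submodule.coe_smul, LinearMap.smul_apply,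
    real_inner_smul_right, map_smul, smul_eq_mul, ← Finset.mul_sum]
  ring

/-- The inner product `⟨(A, x), (B, y)⟩ = Tr(Aᵀ B) + ⟨x, y⟩` on `𝔤𝔩(n, ℝ) ⊕ 𝔤`. -/
noncomputable def algForm (θ : CartanInvolution 𝔤) (n : ℕ) :
    LinearMap.BilinForm ℝ (Module.End ℝ (Euc n) × 𝔤) :=
  LinearMap.mk₂ ℝ
    (fun α β => ∑ i, inner ℝ (α.1 (stdBasis n i)) (β.1 (stdBasis n i)) + θ.form α.2 β.2)
    (by
      intro α β γ
      simp only [Prod.fst_add, Prod.snd_add, LinearMap.add_apply, inner_add_left, map_add,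
        Finset.sum_add_distrib]
      ring)
    (by
      intro c α β
      simp only [Prod.smul_fst, Prod.smul_snd, LinearMap.smul_apply, real_inner_smul_left,
        map_smul, smul_eq_mul, ← Finset.mul_sum]
      ring)
    (by
      intro α β γ
      simp only [Prod.fst_add, Prod.snd_add, LinearMap.add_apply, inner_add_right, map_add,
        Finset.sum_add_distrib]
      ring)
    (by
      intro c α β
      simp only [Prod.smul_fst, Prod.smul_snd, LinearMap.smul_apply, real_inner_smul_right,
        map_smul, smul_eq_mul, ← Finset.mul_sum]
      ring)

theorem algForm_apply (θ : CartanInvolution 𝔤) (n : ℕ) (α β : Module.End ℝ (Euc n) × 𝔤) :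
    algForm θ n α β =
      ∑ i, inner ℝ (α.1 (stdBasis n i)) (β.1 (stdBasis n i)) + θ.form α.2 β.2 := rfl

theorem algForm_self_eq_zero (θ : CartanInvolution 𝔤) (n : ℕ)
    (α : Module.End ℝ (Euc n) × 𝔤) (h : algForm θ n α α = 0) : α = 0 := by
  rw [algForm_apply] at h
  have h1 : 0 ≤ ∑ i, inner ℝ (α.1 (stdBasis n i)) (α.1 (stdBasis n i)) :=
    Finset.sum_nonneg fun i _ => real_inner_self_nonneg
  have h2 : α.2 = 0 := by
    by_contra hne
    have := θ.pos _ hne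
    rw [← θ.form_apply] at this
    linarith
  have h3 : ∑ i, inner ℝ (α.1 (stdBasis n i)) (α.1 (stdBasis n i)) = 0 := by
    simpa [h2] using h
  rw [Finset.sum_eq_zero_iff_of_nonneg fun i _ => real_inner_self_nonneg] at h3
  refine Prod.ext ((stdBasis n).toBasis.ext fun i => ?_) h2
  simpa using h3 i (Finset.mem_univ i)

theorem algForm_nondegenerate (θ : CartanInvolution 𝔤) (n : ℕ) :
    (algForm θ n).Nondegenerate :=
  ⟨fun α h => algForm_self_eq_zero θ n α (h α), fun α h => algForm_self_eq_zero θ n α (h α)⟩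

/-- The functional `α ↦ ⟨α · v, v⟩ / ‖v‖²` on `𝔤𝔩(n, ℝ) ⊕ 𝔤`. -/
noncomputable def momentFunctional (θ : CartanInvolution 𝔤) {n : ℕ} (v : Rep 𝔤 n) :
    Module.Dual ℝ (Module.End ℝ (Euc n) × 𝔤) where
  toFun α := repInner θ (infAct α v) v / repInner θ v v
  map_add' α β := by rw [infAct_add, repInner_add_left, add_div]
  map_smul' c α := by
    rw [infAct_smul, repInner_smul_left, mul_div_assoc, smul_eq_mul, RingHom.id_apply]

/-- The moment map `m`: the vector `m(v)` of `𝔤𝔩(n, ℝ) ⊕ 𝔤` determined by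
`⟨m(v), α⟩ = ⟨α · v, v⟩ / ‖v‖²` for all `α`. The maximal compact subalgebra acts by skew-symmetric
maps, so `m(v)` is orthogonal to it. -/
noncomputable def moment [FiniteDimensional ℝ 𝔤] (θ : CartanInvolution 𝔤) {n : ℕ}
    (v : Rep 𝔤 n) : Module.End ℝ (Euc n) × 𝔤 :=
  ((algForm θ n).toDual (algForm_nondegenerate θ n)).symm (momentFunctional θ v)

theorem algForm_moment [FiniteDimensional ℝ 𝔤] (θ : CartanInvolution 𝔤) {n : ℕ}
    (v : Rep 𝔤 n) (α : Module.End ℝ (Euc n) × 𝔤) :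
    algForm θ n (moment θ v) α = repInner θ (infAct α v) v / repInner θ v v := by
  have h := LinearMap.BilinForm.apply_toDual_symm_apply
    (hB := algForm_nondegenerate θ n) (momentFunctional θ v) α
  exact h

/-- The energy `‖m(v)‖²` of a nonzero vector `v`. -/
noncomputable def vecEnergy [FiniteDimensional ℝ 𝔤] (θ : CartanInvolution 𝔤) {n : ℕ}
    (v : Rep 𝔤 n) : ℝ :=
  algForm θ n (moment θ v) (moment θ v)

theorem vecEnergy_smul [FiniteDimensional ℝ 𝔤] (θ : CartanInvolution 𝔤) {n : ℕ} (c : ℝ)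
    (hc : c ≠ 0) (v : Rep 𝔤 n) : vecEnergy θ (c • v) = vecEnergy θ v := by
  have h : momentFunctional θ (c • v) = momentFunctional θ v := by
    refine LinearMap.ext fun α => ?_
    change repInner θ (infAct α (c • v)) (c • v) / repInner θ (c • v) (c • v) =
      repInner θ (infAct α v) v / repInner θ v v
    rw [infAct_smul_right]
    simp only [repInner_smul_left, repInner_smul_right]
    rw [mul_div_mul_left _ _ hc, mul_div_mul_left _ _ hc]
  simp only [vecEnergy, moment, h]

/-- The energy functional `E(μ : φ) = ‖m(μ : φ)‖²` on projective space. -/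
noncomputable def energy [FiniteDimensional ℝ 𝔤] (θ : CartanInvolution 𝔤) {n : ℕ}
    (p : Projectivization ℝ (Rep 𝔤 n)) : ℝ :=
  Projectivization.lift (fun v : {v : Rep 𝔤 n // v ≠ 0} => vecEnergy θ v.1)
    (by
      rintro ⟨a, ha⟩ ⟨b, hb⟩ t h
      have ht : t ≠ 0 := by
        rintro rfl
        exact ha (by simpa using h)
      change vecEnergy θ a = vecEnergy θ b
      have h' : a = t • b := h
      rw [h', vecEnergy_smul θ t ht]) p

theorem energy_mk [FiniteDimensional ℝ 𝔤] (θ : CartanInvolution 𝔤) {n : ℕ} (v : Rep 𝔤 n)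
    (hv : v ≠ 0) : energy θ (Projectivization.mk ℝ v hv) = vecEnergy θ v := rfl

/-- `p` is a critical point of the energy: in homogeneous coordinates, every directional derivative
of the energy vanishes at `p`. -/
def IsCritical [FiniteDimensional ℝ 𝔤] (θ : CartanInvolution 𝔤) {n : ℕ}
    (p : Projectivization ℝ (Rep 𝔤 n)) : Prop :=
  ∀ (v : Rep 𝔤 n) (hv : v ≠ 0), Projectivization.mk ℝ v hv = p →
    ∀ w : Rep 𝔤 n, HasDerivAt (fun t : ℝ => vecEnergy θ (v + t • w)) 0 0

/-! ### Homotheties, toral subalgebras -/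

/-- `φ : ℝⁿ → 𝔤` is a homothety: an isometric embedding up to a positive factor. -/
def IsHomothety (θ : CartanInvolution 𝔤) {n : ℕ} (φ : Euc n →ₗ[ℝ] 𝔤) : Prop :=
  ∃ c : ℝ, 0 < c ∧ ∀ x y, θ.form (φ x) (φ y) = c * inner ℝ x y

/-- A subspace of `𝔤` is toral if it is a Lie subalgebra consisting of semisimple elements. -/
def IsToral (s : Submodule ℝ 𝔤) : Prop :=
  (∀ x ∈ s, ∀ y ∈ s, ⁅x, y⁆ ∈ s) ∧ ∀ x ∈ s, (LieAlgebra.ad ℝ 𝔤 x).IsSemisimple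

end

end LiePair

namespace LiePair

open Filter Topology Polynomial

/-! ### Kernel and range of a semisimple operator -/

section LinearAlgebra

/-! The element `(-1, 0)` acts as the identity, so `m(v)` has inner product 1 with it; since its
square norm is `n`, the energy is `1/n` plus the square norm of `m(v) - (1/n)(-1, 0)`. Thus `1/n` is
a lower bound, attained exactly when `n⟨α·v, v⟩ = -tr(A)‖v‖²` for all `α = (A, x)`. Any point of
energy `1/n` is a global minimum, hence critical.

For `v = (0, φ)`, the `𝔤𝔩`-part of this condition says that `φ` is a homothety, and the `𝔤`-part
that `∑ [θφeᵢ, φeᵢ] = 0`. As `-ad θx` is the adjoint of `ad x`, the latter gives `∑ ‖[θφeᵢ, y]‖² = ∑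
‖[φeᵢ, y]‖²`; taking `y = φeⱼ` and using commutativity, `[θφx, φy] = 0` for all `x, y`
(`bracket_eq_zero_of_sum_eq_zero`). So `im φ + θ(im φ)` is abelian. A maximal abelian `θ`-stable
subspace containing it is a Cartan subalgebra, because elements with `[θx, x] = 0` have normal,
hence semisimple, `ad x`.

For the orbit statement, it remains to conjugate a commuting space of semisimple elements into one
satisfying `[θx, y] = 0`. Some element `x` of the space has the smallest `ker ad`, and it suffices
to make `x` normal (`exists_mem_forall_bracket_eq_zero`). For one semisimple `x`, a vector `y` of
least norm in the closure of the orbit is normal. By a slice argument the orbit contains some `y +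
z` with `z` small and centralizing `y`; the separable minimal polynomial of `ad x` kills both `ad y`
and `ad (y + z)`, and its roots are isolated among commuting operators, so `z = 0`
(`exists_mem_bracket_eq_zero`). A change of basis of `ℝⁿ` then makes the map a homothety. -/

theorem mul_self_apply_eq_zero_of_isSemisimple {V : Type*} [AddCommGroup V] [Module ℝ V]
    [FiniteDimensional ℝ V] {T : Module.End ℝ V} (hT : T.IsSemisimple) {v : V}
    (hv : T (T v) = 0) : T v = 0 := by
  have h := Module.End.IsFinitelySemisimple.maxGenEigenspace_eq_eigenspace
    hT.isFinitelySemisimple 0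
  have h1 : v ∈ T.maxGenEigenspace 0 := by
    rw [Module.End.mem_maxGenEigenspace]
    exact ⟨2, by simpa [pow_two] using hv⟩
  rw [h, Module.End.mem_eigenspace_iff] at h1
  simpa using h1

/-- Disjointness is the absence of nilpotent blocks at eigenvalue 0; rank-nullity does the rest. -/
theorem isCompl_ker_range_of_isSemisimple {V : Type*} [AddCommGroup V] [Module ℝ V]
    [FiniteDimensional ℝ V] {T : Module.End ℝ V} (hT : T.IsSemisimple) :
    IsCompl (LinearMap.ker T) (LinearMap.range T) := by
  have hd : Disjoint (LinearMap.ker T) (LinearMap.range T) := by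
    rw [Submodule.disjoint_def]
    rintro x hx ⟨u, rfl⟩
    exact mul_self_apply_eq_zero_of_isSemisimple hT hx
  refine ⟨hd, codisjoint_iff.mpr (Submodule.eq_top_of_disjoint _ _ ?_ hd)⟩
  rw [add_comm, LinearMap.finrank_range_add_finrank_ker]

end LinearAlgebra

/-! ### Isolated roots of separable polynomials -/

section BanachAlgebra

variable {R : Type*} [NormedRing R] [NormedAlgebra ℝ R]

/-- The divided difference `(p(a) - p(b)) / (a - b)` of a polynomial. -/
noncomputable def dividedDifference (p : ℝ[X]) (a b : R) : R :=
  ∑ k ∈ p.support, p.coeff k • ∑ i ∈ Finset.range k, a ^ i * b ^ (k - 1 - i)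

theorem dividedDifference_mul_sub (p : ℝ[X]) {a b : R} (h : Commute a b) :
    dividedDifference p a b * (a - b) = aeval a p - aeval b p := by
  simp only [dividedDifference, Finset.sum_mul, smul_mul_assoc, h.geom_sum₂_mul,
    smul_sub, Finset.sum_sub_distrib, aeval_def, eval₂_eq_sum, Polynomial.sum, ← Algebra.smul_def]

theorem dividedDifference_self (p : ℝ[X]) (a : R) :
    dividedDifference p a a = aeval a (derivative p) := by
  rw [dividedDifference, derivative_apply, Polynomial.sum, map_sum]
  refine Finset.sum_congr rfl fun k _ => ?_
  have h : ∀ i ∈ Finset.range k, a ^ i * a ^ (k - 1 - i) = a ^ (k - 1) := by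
    intro i hi
    rw [Finset.mem_range] at hi
    rw [← pow_add]
    congr 1
    omega
  rw [Finset.sum_congr rfl h, Finset.sum_const, Finset.card_range]
  simp [Algebra.smul_def, mul_assoc]

theorem continuous_dividedDifference (p : ℝ[X]) (b : R) :
    Continuous fun a : R => dividedDifference p a b := by
  unfold dividedDifference
  fun_prop

/-- A root `b` of a separable polynomial in a Banach algebra is isolated among the roots which
commute with `b`. -/
theorem eventually_eq_of_aeval_eq_zero [CompleteSpace R] {p : ℝ[X]} (hp : p.Separable) {b : R}
    (hb : aeval b p = 0) : ∀ᶠ a in 𝓝 b, Commute a b → aeval a p = 0 → a = b := by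
  -- On the diagonal the divided difference is `p'(b)`; evaluating `s p + t p' = 1` at the root `b`
  -- makes `t(b)` its inverse.
  have hu : IsUnit (dividedDifference p b b) := by
    obtain ⟨s, t, hst⟩ := hp
    have h := congrArg (aeval b) hst
    simp only [map_add, map_mul, hb, mul_zero, zero_add, map_one] at h
    rw [dividedDifference_self]
    refine ⟨⟨_, aeval b t, ?_, h⟩, rfl⟩
    rw [← map_mul, mul_comm, map_mul, h]
  -- Units form an open set, so near `b` the factor in front of `a - b` can be cancelled.
  have ho : ∀ᶠ a in 𝓝 b, IsUnit (dividedDifference p a b) :=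
    (continuous_dividedDifference p b).continuousAt.eventually (Units.isOpen.mem_nhds hu)
  filter_upwards [ho] with a ha hab h0
  have h := dividedDifference_mul_sub p hab
  rw [h0, hb, sub_zero] at h
  exact sub_eq_zero.mp (ha.mul_right_eq_zero.mp h)

end BanachAlgebra

/-! ### Normal operators and smallest kernels -/

section InnerProductSpace

variable {E : Type*} [NormedAddCommGroup E] [InnerProductSpace ℝ E] [FiniteDimensional ℝ E]

open ContinuousLinearMap

/-- For a normal operator, `‖T* v‖ = ‖T v‖`. -/
theorem adjoint_apply_eq_zero_iff_of_commute {T : E →L[ℝ] E} (h : Commute (adjoint T) T) (v : E) :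
    adjoint T v = 0 ↔ T v = 0 := by
  have h1 : inner ℝ (adjoint T v) (adjoint T v) = inner ℝ (T v) (T v) := by
    rw [adjoint_inner_left, ← adjoint_inner_right, real_inner_comm]
    have h2 : adjoint T (T v) = T (adjoint T v) := DFunLike.congr_fun h v
    rw [← h2, adjoint_inner_right, adjoint_inner_left, real_inner_comm]
  rw [← inner_self_eq_zero (𝕜 := ℝ), h1, inner_self_eq_zero]

theorem isSemisimple_of_inner_neg {T : Module.End ℝ E}
    (h : ∀ x y, inner ℝ (T x) y = -inner ℝ x (T y)) : T.IsSemisimple := by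
  rw [Module.End.isSemisimple_iff]
  intro p hp
  refine ⟨pᗮ, fun x hx y hy => ?_, Submodule.isCompl_orthogonal p⟩
  rw [← neg_eq_zero, ← h]
  exact hx _ (hp hy)

/-- A normal operator is half the sum of `T + T*` and `T - T*`, a symmetric and a skew operator
which commute; sums of commuting semisimple operators over `ℝ` are semisimple. -/
theorem isSemisimple_of_commute_adjoint {T : E →L[ℝ] E} (h : Commute (adjoint T) T) :
    Module.End.IsSemisimple (T : E →ₗ[ℝ] E) := by
  set S : E →L[ℝ] E := adjoint T with hS
  have h1 : Module.End.IsSemisimple ((T + S : E →L[ℝ] E) : E →ₗ[ℝ] E) := by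
    refine Module.End.isFinitelySemisimple_iff_isSemisimple.mp
      (LinearMap.IsSymmetric.isFinitelySemisimple fun x y => ?_)
    simp only [coe_coe, add_apply, inner_add_left, inner_add_right, hS, adjoint_inner_left,
      adjoint_inner_right]
    ring
  have h2 : Module.End.IsSemisimple ((T - S : E →L[ℝ] E) : E →ₗ[ℝ] E) := by
    refine isSemisimple_of_inner_neg fun x y => ?_
    simp only [coe_coe, sub_apply, inner_sub_left, inner_sub_right, hS, adjoint_inner_left,
      adjoint_inner_right]
    ring
  have hc : Commute (T + S) (T - S) :=
    (((Commute.refl T).sub_right h.symm).add_left (h.sub_right (Commute.refl S)))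
  have hc' : Commute (((T + S : E →L[ℝ] E) : E →ₗ[ℝ] E) : Module.End ℝ E)
      ((T - S : E →L[ℝ] E) : E →ₗ[ℝ] E) := by
    have := congrArg (fun f : E →L[ℝ] E => (f : E →ₗ[ℝ] E)) hc
    exact this
  have h3 := Module.End.IsSemisimple_smul (1 / 2 : ℝ) (h1.add_of_commute hc' h2)
  have h4 : (T : E →ₗ[ℝ] E) =
      (1 / 2 : ℝ) • (((T + S : E →L[ℝ] E) : E →ₗ[ℝ] E) + ((T - S : E →L[ℝ] E) : E →ₗ[ℝ] E)) := by
    refine LinearMap.ext fun x => ?_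
    simp only [coe_coe, LinearMap.smul_apply, LinearMap.add_apply, add_apply, sub_apply]
    rw [add_add_sub_cancel, ← two_smul ℝ, smul_smul]
    norm_num
  rw [h4]
  exact h3

/-- If `A` is semisimple, then for some `t ≠ 0` the kernel of `A + t B` is contained in that
of `A`, whenever `B` commutes with `A`. -/
theorem exists_ker_add_smul_le {A B : Module.End ℝ E} (hA : A.IsSemisimple) (hAB : Commute A B) :
    ∃ t : ℝ, t ≠ 0 ∧ LinearMap.ker (A + t • B) ≤ LinearMap.ker A := by
  have hc := isCompl_ker_range_of_isSemisimple hA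
  have hinj : LinearMap.ker (A.domRestrict (LinearMap.range A)) = ⊥ := by
    rw [LinearMap.ker_eq_bot']
    rintro ⟨u, hu⟩ h0
    exact Subtype.ext (Submodule.disjoint_def.mp hc.disjoint u h0 hu)
  obtain ⟨K, hK, hanti⟩ := LinearMap.exists_antilipschitzWith _ hinj
  set B' : E →L[ℝ] E := LinearMap.toContinuousLinearMap B
  have hAB' : ∀ u, A (B u) = B (A u) := fun u => DFunLike.congr_fun hAB u
  have hden : 0 < (K : ℝ) * ‖B'‖ + 1 := by positivity
  -- `K` bounds the inverse of `A` on its range, so this choice gives `K t ‖B‖ < 1`; the summand 1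
  -- keeps the denominator positive.
  refine ⟨1 / ((K : ℝ) * ‖B'‖ + 1), (by positivity), fun u hu => ?_⟩
  set t : ℝ := 1 / ((K : ℝ) * ‖B'‖ + 1) with ht
  have ht0 : 0 < t := by positivity
  obtain ⟨k, hk, r, hr, rfl⟩ : ∃ k ∈ LinearMap.ker A, ∃ r ∈ LinearMap.range A, k + r = u :=
    Submodule.mem_sup.mp (hc.sup_eq_top ▸ Submodule.mem_top)
  rw [LinearMap.mem_ker] at hk hu ⊢
  obtain ⟨s, rfl⟩ := hr
  -- With `u = k + A s`, the image of `u` splits into `t B k` in the kernel of `A` and a part in its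
  -- range, so each part vanishes. The estimate below then forces `A s = 0`.
  have h1 : A (t • B k) = 0 := by rw [map_smul, hAB', hk, map_zero, smul_zero]
  have h2 : t • B k + (A + t • B) (A s) = 0 := by
    have : (A + t • B) k = t • B k := by simp [hk]
    rw [← this, ← map_add, hu]
  have h3 : (A + t • B) (A s) ∈ LinearMap.range A :=
    ⟨A s + t • B s, by simp [hAB']⟩
  have h4 : (A + t • B) (A s) = 0 := by
    refine Submodule.disjoint_def.mp hc.disjoint _ ?_ h3
    rw [LinearMap.mem_ker, eq_neg_of_add_eq_zero_right h2, map_neg, h1, neg_zero]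
  have h5 : ‖A s‖ ≤ K * ‖A (A s)‖ := by
    simpa using hanti.le_mul_norm (x := ⟨A s, LinearMap.mem_range_self _ s⟩)
  have h6 : ‖A (A s)‖ = t * ‖B (A s)‖ := by
    have : A (A s) = -(t • B (A s)) := eq_neg_of_add_eq_zero_left (by simpa using h4)
    rw [this, norm_neg, norm_smul, Real.norm_of_nonneg ht0.le]
  have h7 : ‖B (A s)‖ ≤ ‖B'‖ * ‖A s‖ := B'.le_opNorm (A s)
  have h8 : K * t * ‖B'‖ < 1 := by
    rw [ht, mul_one_div, div_mul_eq_mul_div, div_lt_one hden]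
    linarith
  have h9 : ‖A s‖ ≤ K * t * ‖B'‖ * ‖A s‖ := by
    calc ‖A s‖ ≤ K * (t * ‖B (A s)‖) := h6 ▸ h5
      _ ≤ K * (t * (‖B'‖ * ‖A s‖)) := by gcongr
      _ = _ := by ring
  have h10 : ‖A s‖ = 0 := by
    by_contra hne
    have : 0 < ‖A s‖ := lt_of_le_of_ne (norm_nonneg _) (Ne.symm hne)
    nlinarith
  rw [map_add, hk, norm_eq_zero.mp h10, map_zero, add_zero]

/-- A linear space of commuting operators, parametrized linearly by `V`, and consisting of
semisimple operators, has an element with the smallest kernel. -/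
theorem exists_ker_le_of_isSemisimple {V : Type*} [AddCommGroup V] [Module ℝ V]
    (ρ : V →ₗ[ℝ] Module.End ℝ E) (hss : ∀ x, (ρ x).IsSemisimple)
    (hcomm : ∀ x y, Commute (ρ x) (ρ y)) :
    ∃ x, ∀ y, LinearMap.ker (ρ x) ≤ LinearMap.ker (ρ y) := by
  obtain ⟨x, hx⟩ : ∃ x, ∀ y, Module.finrank ℝ (LinearMap.ker (ρ x)) ≤
      Module.finrank ℝ (LinearMap.ker (ρ y)) := by
    obtain ⟨x, -, hx⟩ := WellFounded.has_min
      (InvImage.wf (fun x : V => Module.finrank ℝ (LinearMap.ker (ρ x))) Nat.lt_wfRel.wf)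
      Set.univ ⟨0, trivial⟩
    exact ⟨x, fun y => not_lt.mp (hx y trivial)⟩
  refine ⟨x, fun y u hu => ?_⟩
  obtain ⟨t, ht, hle⟩ := exists_ker_add_smul_le (hss x) (hcomm x y)
  have hle' : LinearMap.ker (ρ (x + t • y)) ≤ LinearMap.ker (ρ x) := by simpa using hle
  -- Minimality of the dimension turns the inclusion into equality, so `u` is killed by both `ρ x`
  -- and `ρ x + t ρ y`.
  have heq := Submodule.eq_of_le_of_finrank_le hle' (hx _)
  have hu' : u ∈ LinearMap.ker (ρ (x + t • y)) := heq ▸ hu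
  rw [LinearMap.mem_ker] at hu hu' ⊢
  simpa [hu, ht] using hu'

end InnerProductSpace

/-! ### Lie brackets with a Cartan involution on a Euclidean space -/

section Bracket

open ContinuousLinearMap

variable {E : Type*} [NormedAddCommGroup E] [InnerProductSpace ℝ E] [FiniteDimensional ℝ E]

/-- `β` is a Lie bracket on the inner product space `E`, with trivial centre, and `θ` is an
involutive automorphism of `β` such that `-β (θ x)` is the adjoint of `β x`. -/
structure IsCartanBracket (β : E →L[ℝ] E →L[ℝ] E) (θ : E →ₗ[ℝ] E) : Prop where
  skew : ∀ x y, β x y = -β y x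
  jacobi : ∀ x y, β (β x y) = β x * β y - β y * β x
  faithful : ∀ x, β x = 0 → x = 0
  map_bracket : ∀ x y, θ (β x y) = β (θ x) (θ y)
  involutive : ∀ x, θ (θ x) = x
  adjoint_eq : ∀ x, adjoint (β x) = -β (θ x)

theorem exp_mul_exp_neg (a : E →L[ℝ] E) : NormedSpace.exp a * NormedSpace.exp (-a) = 1 := by
  let _ : NormedAlgebra ℚ (E →L[ℝ] E) := NormedAlgebra.restrictScalars ℚ ℝ (E →L[ℝ] E)
  have h := NormedSpace.exp_add_of_commute (Commute.neg_right (Commute.refl a))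
  rw [← h, add_neg_cancel, NormedSpace.exp_zero]

omit [FiniteDimensional ℝ E] in
theorem coe_aeval (T : E →L[ℝ] E) (p : ℝ[X]) :
    ((aeval T p : E →L[ℝ] E) : E →ₗ[ℝ] E) = aeval (R := ℝ) (A := Module.End ℝ E) T p := by
  let F : (E →L[ℝ] E) →ₐ[ℝ] Module.End ℝ E :=
    { ContinuousLinearMap.toLinearMapRingHom with commutes' := fun _ => rfl }
  exact (aeval_algHom_apply F T p).symm

namespace IsCartanBracket

variable {β : E →L[ℝ] E →L[ℝ] E} {θ : E →ₗ[ℝ] E} (h : IsCartanBracket β θ)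

include h

theorem inner_bracket (x u v : E) : inner ℝ (β x u) v = -inner ℝ u (β (θ x) v) := by
  rw [← adjoint_inner_right, h.adjoint_eq, neg_apply, inner_neg_right]

theorem bracket_self (x : E) : β x x = 0 := by
  have h1 := h.skew x x
  have h2 : (2 : ℝ) • β x x = 0 := by rw [two_smul, ← eq_neg_iff_add_eq_zero, ← h1]
  simpa using h2

theorem commute_of_bracket_eq_zero {x y : E} (hxy : β x y = 0) : Commute (β x) (β y) := by
  have h1 := h.jacobi x y
  rw [hxy, map_zero] at h1
  exact (sub_eq_zero.mp h1.symm)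

theorem commute_adjoint {x : E} (hx : β (θ x) x = 0) : Commute (adjoint (β x)) (β x) := by
  rw [h.adjoint_eq]
  exact (h.commute_of_bracket_eq_zero hx).neg_left

/-- Scaling `w` by `t` gives a curve with zero derivative, since the Jacobi identity makes `β w` a
derivation; compare `t = 1` with `t = 0`. -/
theorem exp_neg_mul_mul_exp (w v : E) :
    NormedSpace.exp (-β w) * β (NormedSpace.exp (β w) v) * NormedSpace.exp (β w) = β v := by
  set F : ℝ → E →L[ℝ] E := fun t => NormedSpace.exp (t • -β w) *
    β (NormedSpace.exp (t • β w) v) * NormedSpace.exp (t • β w) with hF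
  have hd : ∀ t, HasDerivAt F 0 t := by
    intro t
    have h1 := hasDerivAt_exp_smul_const (-β w) t
    have h2 := hasDerivAt_exp_smul_const' (β w) t
    have h3 : HasDerivAt (fun t : ℝ => β (NormedSpace.exp (t • β w) v))
        (β ((β w * NormedSpace.exp (t • β w)) v)) t :=
      β.hasFDerivAt.comp_hasDerivAt t
        ((ContinuousLinearMap.apply ℝ E v).hasFDerivAt.comp_hasDerivAt t h2)
    refine ((h1.mul h3).mul h2).congr_deriv ?_
    have h4 : β ((β w * NormedSpace.exp (t • β w)) v) =
        β w * β (NormedSpace.exp (t • β w) v) - β (NormedSpace.exp (t • β w) v) * β w :=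
      h.jacobi w _
    simp only [Pi.mul_apply, h4]
    noncomm_ring
  have hc := is_const_of_deriv_eq_zero (fun t => (hd t).differentiableAt)
    (fun t => (hd t).deriv) 1 0
  simpa [hF, NormedSpace.exp_zero] using hc

/-- The exponential of `β w` is an automorphism of `β`. -/
theorem exp_bracket (w u v : E) : NormedSpace.exp (β w) (β u v) =
    β (NormedSpace.exp (β w) u) (NormedSpace.exp (β w) v) := by
  have h1 := h.exp_neg_mul_mul_exp w u
  have h2 := exp_mul_exp_neg (β w)
  have h3 : NormedSpace.exp (β w) * β u = β (NormedSpace.exp (β w) u) * NormedSpace.exp (β w) := by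
    rw [← h1, ← mul_assoc, ← mul_assoc, h2, one_mul]
  exact DFunLike.congr_fun h3 v

/-- A commuting family with vanishing moment map is normal. -/
theorem bracket_eq_zero_of_sum_eq_zero {ι : Type*} [Fintype ι] {x : ι → E}
    (hx : ∀ i j, β (x i) (x j) = 0) (hm : ∀ w, ∑ i, inner ℝ (β w (x i)) (x i) = 0) (i j : ι) :
    β (θ (x i)) (x j) = 0 := by
  -- Testing the moment condition on `w` equal to this very sum gives its square norm.
  have h1 : ∑ i, β (θ (x i)) (x i) = 0 := by
    rw [← inner_self_eq_zero (𝕜 := ℝ), inner_sum]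
    rw [← hm (∑ i, β (θ (x i)) (x i))]
    refine Finset.sum_congr rfl fun i _ => ?_
    rw [h.skew (∑ i, β (θ (x i)) (x i)) (x i), inner_neg_left, h.inner_bracket, neg_neg]
  have h2 : ∀ y, ∑ i, inner ℝ (β (θ (x i)) y) (β (θ (x i)) y) =
      ∑ i, inner ℝ (β (x i) y) (β (x i) y) := by
    intro y
    rw [← sub_eq_zero, ← Finset.sum_sub_distrib]
    have h3 : ∀ i, inner ℝ (β (θ (x i)) y) (β (θ (x i)) y) - inner ℝ (β (x i) y) (β (x i) y) =
        inner ℝ y (β (β (θ (x i)) (x i)) y) := by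
      intro i
      rw [h.inner_bracket (θ (x i)), h.inner_bracket (x i), h.involutive, h.jacobi,
        sub_apply, mul_apply_eq_comp, mul_apply_eq_comp, inner_sub_right]
      ring
    rw [Finset.sum_congr rfl fun i _ => h3 i, ← inner_sum]
    have h4 : ∑ i, β (β (θ (x i)) (x i)) y = β (∑ i, β (θ (x i)) (x i)) y := by
      rw [map_sum, sum_apply]
    rw [h4, h1, map_zero, zero_apply, inner_zero_right]
  have h5 := h2 (x j)
  simp only [hx, inner_zero_left, Finset.sum_const_zero] at h5
  rw [Finset.sum_eq_zero_iff_of_nonneg fun i _ => real_inner_self_nonneg] at h5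
  exact inner_self_eq_zero.mp (h5 i (Finset.mem_univ i))

/-- A vector whose norm is minimal in its orbit is normal. -/
theorem bracket_eq_zero_of_norm_le {y : E}
    (hy : ∀ w, ‖y‖ ≤ ‖NormedSpace.exp (β w) y‖) : β (θ y) y = 0 := by
  refine h.bracket_eq_zero_of_sum_eq_zero (x := fun _ : Unit => y) (fun _ _ => h.bracket_self y)
    (fun w => ?_) () ()
  rw [Fintype.sum_unique]
  have h1 := hasDerivAt_exp_smul_const (β w) (0 : ℝ)
  have h2 : HasDerivAt (fun t : ℝ => NormedSpace.exp (t • β w) y) (β w y) 0 := by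
    refine ((ContinuousLinearMap.apply ℝ E y).hasFDerivAt.comp_hasDerivAt 0 h1).congr_deriv ?_
    simp [NormedSpace.exp_zero]
  have h3 := h2.norm_sq
  -- The first variation of the square norm along `exp (t β w) y` is `2⟨β w y, y⟩`, which is the
  -- moment condition for the family consisting of `y` alone.
  have hmin : IsLocalMin (fun t : ℝ => ‖NormedSpace.exp (t • β w) y‖ ^ 2) 0 := by
    refine Filter.Eventually.of_forall fun t => ?_
    have h4 := hy (t • w)
    rw [map_smul] at h4
    simp only [zero_smul, NormedSpace.exp_zero, one_apply_eq_self]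
    gcongr
  have h4 := hmin.hasDerivAt_eq_zero h3
  simp only [zero_smul, NormedSpace.exp_zero, one_apply_eq_self] at h4
  rw [real_inner_comm]
  linarith

/-- Near a normal vector `y`, every vector is conjugate to an element `y + z` with `z` in the
centralizer of `y`. -/
theorem map_nhds_slice {y : E} (hy : Module.End.IsSemisimple (β y : E →ₗ[ℝ] E)) :
    map (fun p : E × LinearMap.ker (β y : E →ₗ[ℝ] E) => NormedSpace.exp (β p.1) (y + p.2)) (𝓝 0) =
      𝓝 y := by
  set K := LinearMap.ker (β y : E →ₗ[ℝ] E)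
  have h1 := (β ∘L ContinuousLinearMap.fst ℝ E K).hasStrictFDerivAt (x := 0)
  have h0 : HasStrictFDerivAt (NormedSpace.exp : (E →L[ℝ] E) → E →L[ℝ] E)
      (1 : (E →L[ℝ] E) →L[ℝ] E →L[ℝ] E)
      ((β ∘L ContinuousLinearMap.fst ℝ E K) 0) := by
    rw [map_zero]
    exact hasStrictFDerivAt_exp_zero
  have h2 := h0.comp 0 h1
  have h3 := (K.subtypeL ∘L ContinuousLinearMap.snd ℝ E K).hasStrictFDerivAt (x := 0) |>.const_add y
  have h4 := h2.clm_apply h3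
  have h5 := h4.map_nhds_eq_of_surj ?_
  · simpa [NormedSpace.exp_zero] using h5
  -- The derivative at 0 is `(s, k) ↦ β s y + k`, onto because the kernel and range of `β y` span;
  -- the sign in the witness comes from skew symmetry.
  · rw [eq_top_iff]
    intro u _
    obtain ⟨k, hk, r, ⟨s, rfl⟩, rfl⟩ :=
      Submodule.mem_sup.mp ((isCompl_ker_range_of_isSemisimple hy).sup_eq_top ▸
        Submodule.mem_top (x := u))
    refine ⟨(-s, ⟨k, hk⟩), ?_⟩
    simp [NormedSpace.exp_zero, h.skew y s]

/-! ### Conjugation to normal elements -/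

section Group

variable {G : Subgroup (E ≃ₗ[ℝ] E)} (hG : ∀ f ∈ G, ∀ x y, f (β x y) = β (f x) (f y))
  (hexp : ∀ w, ∃ f ∈ G, ∀ v, f v = NormedSpace.exp (β w) v)

include hG

omit h in
theorem aeval_map_eq_zero {f : E ≃ₗ[ℝ] E} (hf : f ∈ G) {p : ℝ[X]} {x : E}
    (hp : aeval (β x) p = 0) : aeval (β (f x)) p = 0 := by
  set F := f.toContinuousLinearEquiv
  have h1 : β (f x) = F.conjContinuousAlgEquiv (β x) := by
    ext v
    change β (f x) v = f (β x (f.symm v))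
    rw [hG f hf, f.apply_symm_apply]
  rw [h1, aeval_algHom_apply, hp, map_zero]

include hexp

/-- Every semisimple element is conjugate to a normal one. -/
theorem exists_mem_bracket_eq_zero {x : E} (hx : Module.End.IsSemisimple (β x : E →ₗ[ℝ] E)) :
    ∃ f ∈ G, β (θ (f x)) (f x) = 0 := by
  set S : Set E := {u | ∃ f ∈ G, u = f x} with hS
  obtain ⟨y, hyS, hy⟩ := (isClosed_closure (s := S)).exists_infDist_eq_dist
    ⟨x, subset_closure ⟨1, G.one_mem, rfl⟩⟩ 0
  -- The closure of the orbit is stable under `G`, so its point nearest to 0 also minimizes the norm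
  -- in its own orbit.
  have hmin : ∀ f ∈ G, ‖y‖ ≤ ‖f y‖ := by
    intro f hf
    have h1 : f y ∈ closure S := by
      refine map_mem_closure f.toContinuousLinearEquiv.continuous hyS ?_
      rintro _ ⟨k, hk, rfl⟩
      exact ⟨f * k, G.mul_mem hf hk, rfl⟩
    have h2 := Metric.infDist_le_dist_of_mem (x := (0 : E)) h1
    rwa [hy, dist_zero_left, dist_zero_left] at h2
  have hyn : β (θ y) y = 0 := by
    refine h.bracket_eq_zero_of_norm_le fun w => ?_
    obtain ⟨f, hf, hfw⟩ := hexp w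
    rw [← hfw]
    exact hmin f hf
  have hyss := isSemisimple_of_commute_adjoint (h.commute_adjoint hyn)
  set p := minpoly ℝ (β x : E →ₗ[ℝ] E) with hp
  have hsep : p.Separable := PerfectField.separable_iff_squarefree.mpr hx.minpoly_squarefree
  have hpx : aeval (β x) p = 0 := by
    refine ContinuousLinearMap.coe_injective ?_
    rw [coe_aeval, minpoly.aeval]
    rfl
  have hpS : ∀ f ∈ G, aeval (β (f x)) p = 0 := fun f hf => aeval_map_eq_zero hG hf hpx
  -- Being killed by `p` is conjugation invariant and closed, so it passes to the limit point `y`.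
  have hpy : aeval (β y) p = 0 := by
    have hcl : IsClosed {u | aeval (β u) p = 0} :=
      isClosed_eq ((p.continuous_aeval).comp β.continuous) continuous_const
    refine closure_minimal ?_ hcl hyS
    rintro _ ⟨f, hf, rfl⟩
    exact hpS f hf
  have hev := eventually_eq_of_aeval_eq_zero hsep hpy
  set K := LinearMap.ker (β y : E →ₗ[ℝ] E)
  have hcont : Tendsto (fun q : E × K => β (y + q.2)) (𝓝 0) (𝓝 (β y)) := by
    have : Continuous fun q : E × K => β (y + q.2) := by fun_prop
    simpa using this.tendsto 0
  have himg := image_mem_map (m := fun q : E × K => NormedSpace.exp (β q.1) (y + q.2))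
    (hcont.eventually hev)
  rw [h.map_nhds_slice hyss] at himg
  -- The image of a small slice neighbourhood is a neighbourhood of `y`, so it meets the orbit.
  obtain ⟨_, ⟨⟨w, z⟩, hq, rfl⟩, ⟨f, hf, hfx⟩⟩ := mem_closure_iff_nhds.mp hyS _ himg
  obtain ⟨k, hk, hkw⟩ := hexp w
  have hz : β y z = 0 := z.2
  have hfx' : y + z = (k⁻¹ * f) x := by
    have h1 : k (y + z) = f x := by
      rw [hkw]
      exact hfx
    change _ = k.symm (f x)
    rw [← h1, k.symm_apply_apply]
  have hq' : β (y + z) = β y := by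
    refine hq ?_ ?_
    · change Commute (β (y + z)) (β y)
      refine h.commute_of_bracket_eq_zero ?_
      rw [h.skew, map_add, hz, h.bracket_self, add_zero, neg_zero]
    · change aeval (β (y + z)) p = 0
      rw [hfx']
      exact hpS _ (G.mul_mem (G.inv_mem hk) hf)
  have hz0 : (z : E) = 0 := h.faithful _ (by simpa using hq')
  refine ⟨k⁻¹ * f, G.mul_mem (G.inv_mem hk) hf, ?_⟩
  rw [← hfx', hz0, add_zero, hyn]

/-- Every commuting space of semisimple elements is conjugate to a space of normal elements. -/
theorem exists_mem_forall_bracket_eq_zero {V : Type*} [AddCommGroup V] [Module ℝ V]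
    (ρ : V →ₗ[ℝ] E) (hss : ∀ v, Module.End.IsSemisimple (β (ρ v) : E →ₗ[ℝ] E))
    (hcomm : ∀ u v, β (ρ u) (ρ v) = 0) :
    ∃ f ∈ G, ∀ u v, β (θ (f (ρ u))) (f (ρ v)) = 0 := by
  obtain ⟨x, hx⟩ := exists_ker_le_of_isSemisimple
    (ContinuousLinearMap.coeLM ℝ ∘ₗ (β : E →ₗ[ℝ] E →L[ℝ] E) ∘ₗ ρ) hss fun u v =>
      congrArg (fun T : E →L[ℝ] E => (T : E →ₗ[ℝ] E))
        (h.commute_of_bracket_eq_zero (hcomm u v)).eq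
  replace hx : ∀ v u, β (ρ x) u = 0 → β (ρ v) u = 0 := fun v u hu => hx v hu
  obtain ⟨f, hf, hfx⟩ := h.exists_mem_bracket_eq_zero hG hexp (hss x)
  have hfx' : ∀ v u, β (f (ρ x)) u = 0 → β (f (ρ v)) u = 0 := by
    intro v u hu
    rw [← f.apply_symm_apply u, ← hG f hf] at hu ⊢
    rw [hx v _ ((map_eq_zero_iff f f.injective).mp hu), map_zero]
  refine ⟨f, hf, fun u v => ?_⟩
  rw [h.skew, neg_eq_zero]
  refine hfx' v _ ?_
  -- For the normal element `f (ρ x)`, whatever commutes with it also commutes with its image under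
  -- `θ`. Applying `θ` puts `θ (f (ρ u))` in its centralizer, the smallest one in the family.
  have h1 : β (f (ρ x)) (f (ρ u)) = 0 := by rw [← hG f hf, hcomm, map_zero]
  have h2 := (adjoint_apply_eq_zero_iff_of_commute (h.commute_adjoint hfx) _).mpr h1
  rw [h.adjoint_eq, neg_apply, neg_eq_zero] at h2
  have h3 := congrArg θ h2
  rwa [h.map_bracket, h.involutive, map_zero] at h3

end Group

end IsCartanBracket

end Bracket

/-! ### Transfer to the Lie algebra with the inner product of `θ` -/

section FormSpace

variable {𝔤 : Type*} [LieRing 𝔤] [LieAlgebra ℝ 𝔤]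

theorem CartanInvolution.form_comm (θ : CartanInvolution 𝔤) (x y : 𝔤) :
    θ.form x y = θ.form y x := by
  rw [θ.form_apply, θ.form_apply, ← LieAlgebra.killingForm_of_equiv_apply θ.toEquiv,
    θ.involutive, LieModule.traceForm_comm]

/-- Invariance of the Killing form makes `-ad θx` the adjoint of `ad x`. -/
theorem CartanInvolution.form_lie (θ : CartanInvolution 𝔤) (x u v : 𝔤) :
    θ.form ⁅x, u⁆ v = -θ.form u ⁅θ.toEquiv x, v⁆ := by
  rw [θ.form_apply, θ.form_apply, LieEquiv.map_lie, ← lie_skew, map_neg, LinearMap.neg_apply,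
    LieModule.traceForm_apply_lie_apply]

variable (θ : CartanInvolution 𝔤)

/-- The inner product `-B(θ x, y)` on `𝔤`. -/
noncomputable abbrev formCore : InnerProductSpace.Core ℝ 𝔤 where
  inner x y := θ.form x y
  conj_inner_symm x y := θ.form_comm _ _
  re_inner_nonneg x := by
    rcases eq_or_ne x 0 with h | h
    · simp [h]
    · exact (θ.pos _ h).le
  add_left x y z := by simp
  smul_left x y r := by simp
  definite x hx := by
    by_contra h
    exact (θ.pos x h).ne' hx

/-- The Lie algebra `𝔤` as a Euclidean space, with the inner product `-B(θ x, y)`. -/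
def FormSpace (_θ : CartanInvolution 𝔤) : Type _ := 𝔤

noncomputable instance : NormedAddCommGroup (FormSpace θ) :=
  (formCore θ).toNormedAddCommGroup

noncomputable instance : InnerProductSpace ℝ (FormSpace θ) :=
  InnerProductSpace.ofCore (formCore θ).toCore

/-- The identity map of `𝔤`, with values in the Euclidean space `FormSpace θ`. -/
def toFormSpace : 𝔤 ≃ₗ[ℝ] FormSpace θ := LinearEquiv.refl ℝ 𝔤

instance [FiniteDimensional ℝ 𝔤] : FiniteDimensional ℝ (FormSpace θ) :=
  Module.Finite.equiv (toFormSpace θ)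

variable [FiniteDimensional ℝ 𝔤]

/-- The Lie bracket of `𝔤` as a continuous bilinear map on `FormSpace θ`. -/
noncomputable def formBracket : FormSpace θ →L[ℝ] FormSpace θ →L[ℝ] FormSpace θ :=
  LinearMap.toContinuousLinearMap
    ((LinearMap.toContinuousLinearMap :
        (FormSpace θ →ₗ[ℝ] FormSpace θ) ≃ₗ[ℝ] (FormSpace θ →L[ℝ] FormSpace θ)).toLinearMap ∘ₗ
      (LieAlgebra.ad ℝ 𝔤 : 𝔤 →ₗ[ℝ] Module.End ℝ 𝔤))

omit [FiniteDimensional ℝ 𝔤] in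
theorem CartanInvolution.isKilling (θ : CartanInvolution 𝔤) : LieAlgebra.IsKilling ℝ 𝔤 := by
  refine ⟨?_⟩
  rw [eq_bot_iff]
  intro x hx
  rw [LieSubmodule.mem_bot]
  by_contra h
  rw [LieIdeal.mem_killingCompl] at hx
  have h1 := θ.pos x h
  rw [hx _ trivial] at h1
  simp at h1

omit [FiniteDimensional ℝ 𝔤] in
theorem CartanInvolution.eq_zero_of_lie_eq_zero (θ : CartanInvolution 𝔤) {x : 𝔤}
    (hx : ∀ y : 𝔤, ⁅x, y⁆ = 0) : x = 0 := by
  by_contra h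
  have h1 := θ.pos x h
  have h2 : LieAlgebra.ad ℝ 𝔤 x = 0 := LinearMap.ext hx
  rw [killingForm_apply_apply, h2] at h1
  simp at h1

theorem isCartanBracket_formBracket :
    IsCartanBracket (formBracket θ)
      ((θ.toEquiv : 𝔤 →ₗ[ℝ] 𝔤) : FormSpace θ →ₗ[ℝ] FormSpace θ) where
  skew x y := (lie_skew (L := 𝔤) x y).symm
  jacobi x y := ContinuousLinearMap.ext fun z => lie_lie (L := 𝔤) (M := 𝔤) x y z
  faithful x hx := θ.eq_zero_of_lie_eq_zero fun y => DFunLike.congr_fun hx y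
  map_bracket x y := θ.toEquiv.map_lie x y
  involutive := θ.involutive
  adjoint_eq x := by
    symm
    rw [ContinuousLinearMap.eq_adjoint_iff]
    intro u v
    rw [neg_apply, inner_neg_left]
    have h : ∀ x u v : 𝔤, θ.form ⁅θ.toEquiv x, u⁆ v = -θ.form u ⁅x, v⁆ := by
      intro x u v
      rw [θ.form_lie, θ.involutive]
    exact neg_eq_iff_eq_neg.mpr (h x u v)

open scoped Matrix.Norms.Operator in
theorem toFormSpace_expAd (x v : 𝔤) :
    toFormSpace θ (expAd x v) =
      NormedSpace.exp (formBracket θ (toFormSpace θ x)) (toFormSpace θ v) := by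
  let _ : NormedAlgebra ℚ (FormSpace θ →L[ℝ] FormSpace θ) :=
    NormedAlgebra.restrictScalars ℚ ℝ (FormSpace θ →L[ℝ] FormSpace θ)
  set b := Module.finBasis ℝ 𝔤
  let F : (FormSpace θ →L[ℝ] FormSpace θ) →ₐ[ℝ] Module.End ℝ 𝔤 :=
    { ContinuousLinearMap.toLinearMapRingHom (R₁ := ℝ) (M₁ := FormSpace θ) with
      commutes' := fun _ => rfl }
  let Ψ := (LinearMap.toMatrixAlgEquiv b).toAlgHom.comp F
  -- Continuous algebra homomorphisms commute with `exp`; this identifies the matrix exponential in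
  -- `expAd` with that of operators.
  have hΨ : Continuous Ψ := Ψ.toLinearMap.continuous_of_finiteDimensional
  have h1 := NormedSpace.map_exp Ψ hΨ (formBracket θ (toFormSpace θ x))
  have h2 : expAd x = F (NormedSpace.exp (formBracket θ (toFormSpace θ x))) := by
    change Matrix.toLin b b (NormedSpace.exp (Ψ (formBracket θ (toFormSpace θ x)))) = _
    exact (congrArg (Matrix.toLin b b) h1.symm).trans (Matrix.toLin_toMatrix b b _)
  rw [h2]
  rfl

theorem exists_mem_innerGroup_eq_expAd (x : 𝔤) :
    ∃ f ∈ innerGroup 𝔤, ∀ v, f v = NormedSpace.exp (formBracket θ (toFormSpace θ x)) v := by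
  have h1 := exp_mul_exp_neg (formBracket θ (toFormSpace θ x))
  have h2 := exp_mul_exp_neg (-formBracket θ (toFormSpace θ x))
  rw [neg_neg] at h2
  set e : FormSpace θ →L[ℝ] FormSpace θ := NormedSpace.exp (formBracket θ (toFormSpace θ x))
  set e' : FormSpace θ →L[ℝ] FormSpace θ := NormedSpace.exp (-formBracket θ (toFormSpace θ x))
  let f : FormSpace θ ≃ₗ[ℝ] FormSpace θ := LinearEquiv.ofLinearMap e e'
    (LinearMap.ext fun v => DFunLike.congr_fun h1 v)
    (LinearMap.ext fun v => DFunLike.congr_fun h2 v)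
  refine ⟨(f : 𝔤 ≃ₗ[ℝ] 𝔤), Subgroup.subset_closure ⟨x, LinearMap.ext fun v => ?_⟩, fun v => rfl⟩
  exact (toFormSpace_expAd θ x v).symm

include θ in
theorem map_lie_of_mem_innerGroup {f : 𝔤 ≃ₗ[ℝ] 𝔤} (hf : f ∈ innerGroup 𝔤) :
    ∀ x y, f ⁅x, y⁆ = ⁅f x, f y⁆ := by
  induction hf using Subgroup.closure_induction with
  | mem f hf =>
    obtain ⟨w, hw⟩ := hf
    have h1 : ∀ v, f v = NormedSpace.exp (formBracket θ (toFormSpace θ w)) v := fun v =>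
      (DFunLike.congr_fun hw v).trans (toFormSpace_expAd θ w v)
    intro x y
    rw [h1, h1, h1]
    exact (isCartanBracket_formBracket θ).exp_bracket w x y
  | one => exact fun _ _ => rfl
  | mul f g _ _ hf hg =>
    intro x y
    rw [LinearEquiv.mul_apply, hg, hf]
    rfl
  | inv f _ hf =>
    intro x y
    change f.symm ⁅x, y⁆ = ⁅f.symm x, f.symm y⁆
    rw [f.symm_apply_eq, hf, f.apply_symm_apply, f.apply_symm_apply]

theorem isSemisimple_ad_of_lie_eq_zero {x : 𝔤} (hx : ⁅θ.toEquiv x, x⁆ = 0) :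
    (LieAlgebra.ad ℝ 𝔤 x).IsSemisimple :=
  isSemisimple_of_commute_adjoint
    ((isCartanBracket_formBracket θ).commute_adjoint (x := toFormSpace θ x) hx)

theorem lie_eq_zero_of_sum_form_eq_zero {ι : Type*} [Fintype ι] {x : ι → 𝔤}
    (hx : ∀ i j : ι, ⁅x i, x j⁆ = 0) (hm : ∀ w : 𝔤, ∑ i, θ.form ⁅w, x i⁆ (x i) = 0) (i j : ι) :
    ⁅θ.toEquiv (x i), x j⁆ = 0 :=
  (isCartanBracket_formBracket θ).bracket_eq_zero_of_sum_eq_zero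
    (x := fun i => toFormSpace θ (x i)) hx hm i j

/-- Every commuting space of semisimple elements of `𝔤` is conjugate to a space of elements
commuting with their images under `θ`. -/
theorem exists_mem_innerGroup_forall_lie_eq_zero {V : Type*} [AddCommGroup V] [Module ℝ V]
    (ρ : V →ₗ[ℝ] 𝔤) (hss : ∀ v, (LieAlgebra.ad ℝ 𝔤 (ρ v)).IsSemisimple)
    (hcomm : ∀ u v, ⁅ρ u, ρ v⁆ = 0) :
    ∃ f ∈ innerGroup 𝔤, ∀ u v, ⁅θ.toEquiv (f (ρ u)), f (ρ v)⁆ = 0 :=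
  (isCartanBracket_formBracket θ).exists_mem_forall_bracket_eq_zero (G := innerGroup 𝔤)
    (fun _ hf => map_lie_of_mem_innerGroup θ hf) (exists_mem_innerGroup_eq_expAd θ) ρ hss hcomm

end FormSpace

/-! ### The lower bound for the energy and the case of equality -/

section Energy

variable {𝔤 : Type*} [LieRing 𝔤] [LieAlgebra ℝ 𝔤] (θ : CartanInvolution 𝔤) {n : ℕ}

theorem CartanInvolution.form_self_nonneg (x : 𝔤) : 0 ≤ θ.form x x :=
  real_inner_self_nonneg (F := FormSpace θ)

theorem CartanInvolution.form_self_eq_zero {x : 𝔤} (h : θ.form x x = 0) : x = 0 :=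
  inner_self_eq_zero (𝕜 := ℝ) (E := FormSpace θ) |>.mp h

theorem repInner_self_pos {v : Rep 𝔤 n} (hv : v ≠ 0) : 0 < repInner θ v v := by
  have h1 : 0 ≤ ∑ i, ∑ j, inner ℝ (v.1.1 (stdBasis n i) (stdBasis n j))
      (v.1.1 (stdBasis n i) (stdBasis n j)) :=
    Finset.sum_nonneg fun i _ => Finset.sum_nonneg fun j _ => real_inner_self_nonneg
  have h2 : 0 ≤ ∑ i, θ.form (v.2 (stdBasis n i)) (v.2 (stdBasis n i)) :=
    Finset.sum_nonneg fun i _ => θ.form_self_nonneg _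
  have h3 : 0 ≤ repInner θ v v := by
    unfold repInner
    positivity
  refine h3.lt_of_ne' fun h0 => hv ?_
  unfold repInner at h0
  have h4 : ∑ i, ∑ j, inner ℝ (v.1.1 (stdBasis n i) (stdBasis n j))
      (v.1.1 (stdBasis n i) (stdBasis n j)) = 0 := by linarith
  have h5 : ∑ i, θ.form (v.2 (stdBasis n i)) (v.2 (stdBasis n i)) = 0 := by linarith
  rw [Finset.sum_eq_zero_iff_of_nonneg
    fun i _ => Finset.sum_nonneg fun j _ => real_inner_self_nonneg] at h4
  rw [Finset.sum_eq_zero_iff_of_nonneg fun i _ => θ.form_self_nonneg _] at h5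
  refine Prod.ext (Subtype.ext ((stdBasis n).toBasis.ext fun i =>
    (stdBasis n).toBasis.ext fun j => ?_)) ((stdBasis n).toBasis.ext fun i => ?_)
  · have h6 := h4 i (Finset.mem_univ i)
    rw [Finset.sum_eq_zero_iff_of_nonneg fun j _ => real_inner_self_nonneg] at h6
    simpa using h6 j (Finset.mem_univ j)
  · simpa using θ.form_self_eq_zero (h5 i (Finset.mem_univ i))

theorem repInner_add_right (v w w' : Rep 𝔤 n) :
    repInner θ v (w + w') = repInner θ v w + repInner θ v w' := by
  simp only [repInner, Prod.fst_add, Prod.snd_add, Submodule.coe_add, LinearMap.add_apply,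
    inner_add_right, map_add, Finset.sum_add_distrib]
  ring

theorem infAct_add_right (α : Module.End ℝ (Euc n) × 𝔤) (v w : Rep 𝔤 n) :
    infAct α (v + w) = infAct α v + infAct α w := by
  refine Prod.ext (Subtype.ext (LinearMap.ext₂ fun x y => ?_)) (LinearMap.ext fun x => ?_)
  · change α.1 (v.1.1 x y + w.1.1 x y) - (v.1.1 (α.1 x) y + w.1.1 (α.1 x) y) -
      (v.1.1 x (α.1 y) + w.1.1 x (α.1 y)) = (infAct α v).1.1 x y + (infAct α w).1.1 x y
    simp only [infAct_fst, map_add]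
    abel
  · change ⁅α.2, v.2 x + w.2 x⁆ - (v.2 (α.1 x) + w.2 (α.1 x)) =
      (infAct α v).2 x + (infAct α w).2 x
    simp only [infAct_snd, lie_add]
    abel

theorem ne_zero_of_rep_ne_zero {v : Rep 𝔤 n} (hv : v ≠ 0) : n ≠ 0 := by
  rintro rfl
  refine hv (Prod.ext (Subtype.ext (LinearMap.ext₂ fun x y => ?_)) (LinearMap.ext fun x => ?_))
  · rw [Subsingleton.elim x 0]
    simp
  · rw [Subsingleton.elim x 0]
    simp

variable (𝔤 n) in
/-- The element `(-1, 0)` of `𝔤𝔩(n, ℝ) ⊕ 𝔤`, acting as the identity. -/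
noncomputable def negOne : Module.End ℝ (Euc n) × 𝔤 := (-1, 0)

theorem infAct_negOne (v : Rep 𝔤 n) : infAct (negOne 𝔤 n) v = v := by
  refine Prod.ext (Subtype.ext (LinearMap.ext₂ fun x y => ?_)) (LinearMap.ext fun x => ?_)
  · rw [infAct_fst]
    simp [negOne]
  · rw [infAct_snd]
    simp [negOne]

theorem algForm_negOne (α : Module.End ℝ (Euc n) × 𝔤) :
    algForm θ n (negOne 𝔤 n) α = -LinearMap.trace ℝ _ α.1 := by
  rw [algForm_apply, LinearMap.trace_eq_sum_inner α.1 (stdBasis n)]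
  simp [negOne]

theorem algForm_negOne_self : algForm θ n (negOne 𝔤 n) (negOne 𝔤 n) = n := by
  rw [algForm_negOne]
  simp [negOne]

theorem algForm_comm (α β : Module.End ℝ (Euc n) × 𝔤) : algForm θ n α β = algForm θ n β α := by
  rw [algForm_apply, algForm_apply, θ.form_comm]
  simp only [real_inner_comm]

theorem algForm_self_nonneg (α : Module.End ℝ (Euc n) × 𝔤) : 0 ≤ algForm θ n α α := by
  rw [algForm_apply]
  exact add_nonneg (Finset.sum_nonneg fun i _ => real_inner_self_nonneg) (θ.form_self_nonneg _)

variable [FiniteDimensional ℝ 𝔤]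

theorem algForm_moment_negOne {v : Rep 𝔤 n} (hv : v ≠ 0) :
    algForm θ n (moment θ v) (negOne 𝔤 n) = 1 := by
  rw [algForm_moment, infAct_negOne, div_self (repInner_self_pos θ hv).ne']

/-- Pythagoras: `(1/n)(-1, 0)` is the orthogonal projection of the moment onto the line of `(-1,
0)`. -/
theorem algForm_moment_sub {v : Rep 𝔤 n} (hv : v ≠ 0) :
    algForm θ n (moment θ v - (1 / n : ℝ) • negOne 𝔤 n) (moment θ v - (1 / n : ℝ) • negOne 𝔤 n) =
      vecEnergy θ v - 1 / n := by
  have hn : (n : ℝ) ≠ 0 := Nat.cast_ne_zero.mpr (ne_zero_of_rep_ne_zero hv)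
  simp only [map_sub, map_smul, LinearMap.sub_apply, LinearMap.smul_apply, smul_eq_mul,
    algForm_moment_negOne θ hv, algForm_comm θ (negOne 𝔤 n) (moment θ v), algForm_negOne_self]
  unfold vecEnergy
  field_simp
  ring

/-- The energy is bounded below by `1 / n`. -/
theorem one_div_le_vecEnergy {v : Rep 𝔤 n} (hv : v ≠ 0) : 1 / (n : ℝ) ≤ vecEnergy θ v := by
  have h := algForm_self_nonneg θ (moment θ v - (1 / n : ℝ) • negOne 𝔤 n)
  rw [algForm_moment_sub θ hv] at h
  linarith

theorem vecEnergy_eq_iff {v : Rep 𝔤 n} (hv : v ≠ 0) : vecEnergy θ v = 1 / (n : ℝ) ↔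
    ∀ α : Module.End ℝ (Euc n) × 𝔤,
      n * repInner θ (infAct α v) v = -(LinearMap.trace ℝ _ α.1 * repInner θ v v) := by
  have hn : (n : ℝ) ≠ 0 := Nat.cast_ne_zero.mpr (ne_zero_of_rep_ne_zero hv)
  have hp := (repInner_self_pos θ hv).ne'
  have key : ∀ α : Module.End ℝ (Euc n) × 𝔤,
      algForm θ n (moment θ v - (1 / n : ℝ) • negOne 𝔤 n) α = 0 ↔
        n * repInner θ (infAct α v) v = -(LinearMap.trace ℝ _ α.1 * repInner θ v v) := by
    intro α
    rw [map_sub, map_smul, LinearMap.sub_apply, LinearMap.smul_apply, algForm_moment,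
      algForm_negOne, smul_eq_mul, sub_eq_zero]
    field_simp
  constructor
  · intro h α
    rw [← key]
    have h1 := algForm_moment_sub θ hv
    rw [h, sub_self] at h1
    rw [algForm_self_eq_zero θ n _ h1, map_zero, LinearMap.zero_apply]
  · intro h
    have h1 := algForm_moment_sub θ hv
    rw [(key _).mpr (h _)] at h1
    linarith

omit [FiniteDimensional ℝ 𝔤] in
theorem repInner_infAct_mk_zero (α : Module.End ℝ (Euc n) × 𝔤) (φ : Euc n →ₗ[ℝ] 𝔤) :
    repInner θ (infAct α ((0, φ) : Rep 𝔤 n)) (0, φ) =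
      ∑ i, θ.form ⁅α.2, φ (stdBasis n i)⁆ (φ (stdBasis n i)) -
        ∑ i, θ.form (φ (α.1 (stdBasis n i))) (φ (stdBasis n i)) := by
  simp only [repInner, infAct_snd, map_sub, LinearMap.sub_apply, Finset.sum_sub_distrib]
  simp

theorem vecEnergy_mk_zero_eq_iff {φ : Euc n →ₗ[ℝ] 𝔤} (hφ : ((0, φ) : Rep 𝔤 n) ≠ 0) :
    vecEnergy θ ((0, φ) : Rep 𝔤 n) = 1 / (n : ℝ) ↔ IsHomothety θ φ ∧
      ∀ w : 𝔤, ∑ i, θ.form ⁅w, φ (stdBasis n i)⁆ (φ (stdBasis n i)) = 0 := by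
  have hn : (n : ℝ) ≠ 0 := Nat.cast_ne_zero.mpr (ne_zero_of_rep_ne_zero hφ)
  have hn0 : (0 : ℝ) < n := lt_of_le_of_ne (Nat.cast_nonneg n) hn.symm
  have hp := repInner_self_pos θ hφ
  rw [vecEnergy_eq_iff θ hφ]
  simp only [repInner_infAct_mk_zero]
  constructor
  · intro h
    refine ⟨⟨repInner θ ((0, φ) : Rep 𝔤 n) (0, φ) / n, by positivity, fun x y => ?_⟩, fun w => ?_⟩
    · have h1 := h (InnerProductSpace.rankOne ℝ x y, 0)
      have h2 : ∑ i, θ.form (φ (InnerProductSpace.rankOne ℝ x y (stdBasis n i)))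
          (φ (stdBasis n i)) = θ.form (φ x) (φ y) := by
        have h3 : φ y = ∑ i, (inner ℝ y (stdBasis n i)) • φ (stdBasis n i) := by
          conv_lhs => rw [← (stdBasis n).sum_repr' y, map_sum]
          simp only [map_smul, real_inner_comm]
        rw [h3, map_sum]
        simp
      have h4 : LinearMap.trace ℝ (Euc n) (InnerProductSpace.rankOne ℝ x y) = inner ℝ x y := by
        rw [LinearMap.trace_eq_sum_inner _ (stdBasis n)]
        simp only [ContinuousLinearMap.coe_coe, InnerProductSpace.rankOne_apply,
          inner_smul_right]
        rw [← OrthonormalBasis.sum_inner_mul_inner (stdBasis n) x y]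
        refine Finset.sum_congr rfl fun i _ => ?_
        rw [mul_comm, real_inner_comm, real_inner_comm y]
      simp only [ContinuousLinearMap.coe_coe, h2, h4, zero_lie, map_zero, LinearMap.zero_apply,
        Finset.sum_const_zero] at h1
      field_simp
      linarith
    · have h1 := h (0, w)
      simpa [hn] using h1
  · rintro ⟨⟨c, hc, hφc⟩, hw⟩ α
    rw [hw, zero_sub]
    have h1 : repInner θ ((0, φ) : Rep 𝔤 n) (0, φ) = n * c := by
      simp [repInner, hφc, -EuclideanSpace.basisFun_apply, mul_comm]
    have h2 : ∑ i, θ.form (φ (α.1 (stdBasis n i))) (φ (stdBasis n i)) =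
        c * LinearMap.trace ℝ _ α.1 := by
      rw [LinearMap.trace_eq_sum_inner _ (stdBasis n), Finset.mul_sum]
      simp only [hφc]
      simp only [real_inner_comm]
    rw [h1, h2]
    ring

/-- The functional `α ↦ ⟨α · v, w⟩` on `𝔤𝔩(n, ℝ) ⊕ 𝔤`. -/
noncomputable def infActFunctional (v w : Rep 𝔤 n) :
    Module.Dual ℝ (Module.End ℝ (Euc n) × 𝔤) where
  toFun α := repInner θ (infAct α v) w
  map_add' α β := by rw [infAct_add, repInner_add_left]
  map_smul' c α := by rw [infAct_smul, repInner_smul_left, smul_eq_mul, RingHom.id_apply]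

/-- The energy is differentiable along lines, away from the origin. -/
theorem differentiableAt_vecEnergy {v : Rep 𝔤 n} (hv : v ≠ 0) (w : Rep 𝔤 n) :
    DifferentiableAt ℝ (fun t : ℝ => vecEnergy θ (v + t • w)) 0 := by
  set T := ((algForm θ n).toDual (algForm_nondegenerate θ n)).symm
  set X := T (infActFunctional θ v v)
  set Y := T (infActFunctional θ v w + infActFunctional θ w v)
  set Z := T (infActFunctional θ w w)
  -- Along a line the moment is a quadratic polynomial in `t` divided by the square norm, which is
  -- nonzero at `t = 0`.
  have hm : ∀ t : ℝ, moment θ (v + t • w) =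
      (repInner θ (v + t • w) (v + t • w))⁻¹ • (X + t • Y + t ^ 2 • Z) := by
    intro t
    simp only [X, Y, Z, ← map_smul, ← map_add]
    refine congrArg T (LinearMap.ext fun α => ?_)
    change repInner θ (infAct α (v + t • w)) (v + t • w) / repInner θ (v + t • w) (v + t • w) =
      (repInner θ (v + t • w) (v + t • w))⁻¹ * (repInner θ (infAct α v) v +
        t * (repInner θ (infAct α v) w + repInner θ (infAct α w) v) +
        t ^ 2 * repInner θ (infAct α w) w)
    rw [infAct_add_right, infAct_smul_right, div_eq_inv_mul]
    congr 1
    simp only [repInner_add_left, repInner_add_right, repInner_smul_left, repInner_smul_right]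
    ring
  have hq : repInner θ (v + (0 : ℝ) • w) (v + (0 : ℝ) • w) ≠ 0 := by
    simpa using (repInner_self_pos θ hv).ne'
  simp only [vecEnergy, hm, map_add, map_smul, LinearMap.add_apply, LinearMap.smul_apply,
    smul_eq_mul]
  simp only [repInner_add_left, repInner_add_right, repInner_smul_left,
    repInner_smul_right] at hq ⊢
  fun_prop (disch := assumption)

/-- The value is the global minimum; the lower bound applies for small `t`, where `v + t w` remains
nonzero. -/
theorem isCritical_of_energy_eq {p : Projectivization ℝ (Rep 𝔤 n)}
    (hp : energy θ p = 1 / (n : ℝ)) : IsCritical θ p := by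
  rintro v hv rfl w
  rw [energy_mk] at hp
  have hd := (differentiableAt_vecEnergy θ hv w).hasDerivAt
  suffices h : IsLocalMin (fun t : ℝ => vecEnergy θ (v + t • w)) 0 by
    rwa [h.hasDerivAt_eq_zero hd] at hd
  have hne : ∀ᶠ t : ℝ in nhds 0, v + t • w ≠ 0 := by
    have hpos : ∀ᶠ t : ℝ in nhds 0, repInner θ (v + t • w) (v + t • w) ≠ 0 := by
      have hc : Continuous fun t : ℝ => repInner θ (v + t • w) (v + t • w) := by
        simp only [repInner_add_left, repInner_add_right, repInner_smul_left, repInner_smul_right]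
        fun_prop
      refine hc.continuousAt.eventually_ne ?_
      simpa using (repInner_self_pos θ hv).ne'
    filter_upwards [hpos] with t ht h0
    exact ht (by rw [h0]; simp [repInner])
  filter_upwards [hne] with t ht
  simpa [hp] using one_div_le_vecEnergy θ ht

end Energy

/-! ### Cartan subalgebras and orbits -/

section Main

variable {𝔤 : Type*} [LieRing 𝔤] [LieAlgebra ℝ 𝔤] (θ : CartanInvolution 𝔤) {n : ℕ}

theorem lie_eq_zero_of_mk_mem_projVariety {φ : Euc n →ₗ[ℝ] 𝔤} (hφ : ((0, φ) : Rep 𝔤 n) ≠ 0)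
    (hmem : Projectivization.mk ℝ ((0, φ) : Rep 𝔤 n) hφ ∈ projVariety 𝔤 n) (x y : Euc n) :
    ⁅φ x, φ y⁆ = 0 := by
  obtain ⟨v, hv, hvar, hmk⟩ := hmem
  obtain ⟨a, ha⟩ := (Projectivization.mk_eq_mk_iff' ℝ _ _ hφ hv).mp hmk.symm
  have h1 : a • v.1 = 0 := congrArg Prod.fst ha
  have h2 : a • v.2 = φ := congrArg Prod.snd ha
  have ha0 : a ≠ 0 := by
    rintro rfl
    exact hφ (by rw [← ha, zero_smul])
  have h3 : v.1 = 0 := (smul_eq_zero.mp h1).resolve_left ha0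
  rw [← h2, LinearMap.smul_apply, LinearMap.smul_apply, smul_lie, lie_smul, ← hvar.2, h3]
  simp

theorem sum_form_lie_eq_zero {ι : Type*} [Fintype ι] {x : ι → 𝔤}
    (hx : ∀ i, ⁅θ.toEquiv (x i), x i⁆ = 0) (w : 𝔤) : ∑ i, θ.form ⁅w, x i⁆ (x i) = 0 := by
  refine Finset.sum_eq_zero fun i _ => ?_
  rw [← lie_skew, map_neg, LinearMap.neg_apply, θ.form_lie, hx, map_zero, neg_zero, neg_zero]

variable [FiniteDimensional ℝ 𝔤]

/-- Commutativity upgrades the vanishing moment to normality of the whole image, while normality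
kills each term of the moment sum. -/
theorem vecEnergy_eq_iff_of_lie_eq_zero {φ : Euc n →ₗ[ℝ] 𝔤} (hφ : ((0, φ) : Rep 𝔤 n) ≠ 0)
    (hcomm : ∀ x y, ⁅φ x, φ y⁆ = 0) :
    vecEnergy θ ((0, φ) : Rep 𝔤 n) = 1 / (n : ℝ) ↔
      IsHomothety θ φ ∧ ∀ x y, ⁅θ.toEquiv (φ x), φ y⁆ = 0 := by
  rw [vecEnergy_mk_zero_eq_iff θ hφ]
  refine and_congr_right fun _ =>
    ⟨fun h x y => ?_, fun h w => sum_form_lie_eq_zero θ (fun i => h _ _) w⟩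
  have h1 := lie_eq_zero_of_sum_form_eq_zero θ (x := fun i => φ (stdBasis n i))
    (fun i j => hcomm _ _) h
  rw [← (stdBasis n).sum_repr x, ← (stdBasis n).sum_repr y]
  simp only [map_sum, map_smul, sum_lie, lie_sum, smul_lie, lie_smul, h1, smul_zero,
    Finset.sum_const_zero]

theorem lie_eq_zero_of_lie_lie_eq_zero {x y : 𝔤} (hx : ⁅θ.toEquiv x, x⁆ = 0)
    (hxy : ⁅x, ⁅x, y⁆⁆ = 0) : ⁅x, y⁆ = 0 :=
  mul_self_apply_eq_zero_of_isSemisimple (isSemisimple_ad_of_lie_eq_zero θ hx) hxy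

/-- A `θ`-invariant abelian subspace is contained in a `θ`-invariant Cartan subalgebra. -/
theorem exists_isCartanSubalgebra_of_lie_eq_zero {s : Submodule ℝ 𝔤}
    (hs : ∀ x ∈ s, ∀ y ∈ s, ⁅x, y⁆ = 0) (hθ : ∀ x ∈ s, θ.toEquiv x ∈ s) :
    ∃ 𝔱 : LieSubalgebra ℝ 𝔤, 𝔱.IsCartanSubalgebra ∧ (∀ x ∈ 𝔱, θ.toEquiv x ∈ 𝔱) ∧
      ∀ x ∈ s, x ∈ 𝔱 := by
  obtain ⟨m, ⟨hsm, hm, hmθ⟩, hmax⟩ := WellFounded.has_min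
    (wellFounded_gt (α := Submodule ℝ 𝔤))
    {m | s ≤ m ∧ (∀ x ∈ m, ∀ y ∈ m, ⁅x, y⁆ = 0) ∧ ∀ x ∈ m, θ.toEquiv x ∈ m} ⟨s, le_rfl, hs, hθ⟩
  -- By maximality, an eigenvector of `θ` centralizing `m` can be adjoined to `m` only if it already
  -- lies there. A general centralizing `u` is half the sum of the eigenvectors `u + θu` and `u -
  -- θu`.
  have hmem : ∀ u : 𝔤, (∀ x ∈ m, ⁅x, u⁆ = 0) → ∀ c : ℝ, θ.toEquiv u = c • u → u ∈ m := by
    intro u hu c hc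
    by_contra hum
    have hle : m ≤ m ⊔ Submodule.span ℝ {u} := le_sup_left
    refine hmax (m ⊔ Submodule.span ℝ {u}) ⟨hsm.trans hle, ?_, ?_⟩ (hle.lt_of_ne fun h => hum ?_)
    · intro x hx y hy
      obtain ⟨x, hxm, _, hx', rfl⟩ := Submodule.mem_sup.mp hx
      obtain ⟨y, hym, _, hy', rfl⟩ := Submodule.mem_sup.mp hy
      obtain ⟨a, rfl⟩ := Submodule.mem_span_singleton.mp hx'
      obtain ⟨b, rfl⟩ := Submodule.mem_span_singleton.mp hy'
      have hux : ⁅u, y⁆ = 0 := by rw [← lie_skew, hu y hym, neg_zero]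
      simp only [add_lie, lie_add, smul_lie, lie_smul, lie_self, hm x hxm y hym, hu x hxm, hux,
        smul_zero, add_zero]
    · intro x hx
      obtain ⟨x, hxm, _, hx', rfl⟩ := Submodule.mem_sup.mp hx
      obtain ⟨a, rfl⟩ := Submodule.mem_span_singleton.mp hx'
      rw [map_add, map_smul, hc]
      exact Submodule.add_mem_sup (hmθ x hxm) (Submodule.smul_mem _ _
        (Submodule.smul_mem _ _ (Submodule.mem_span_singleton_self u)))
    · rw [h]
      exact Submodule.mem_sup_right (Submodule.mem_span_singleton_self u)
  have hcent : ∀ u : 𝔤, (∀ x ∈ m, ⁅x, u⁆ = 0) → u ∈ m := by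
    intro u hu
    have hu' : ∀ x ∈ m, ⁅x, θ.toEquiv u⁆ = 0 := by
      intro x hx
      have h1 := congrArg θ.toEquiv (hu _ (hmθ x hx))
      rwa [LieEquiv.map_lie, θ.involutive, map_zero] at h1
    have h1 : u + θ.toEquiv u ∈ m := by
      refine hmem _ (fun x hx => by rw [lie_add, hu x hx, hu' x hx, add_zero]) 1 ?_
      rw [map_add, θ.involutive, one_smul, add_comm]
    have h2 : u - θ.toEquiv u ∈ m := by
      refine hmem _ (fun x hx => by rw [lie_sub, hu x hx, hu' x hx, sub_zero]) (-1) ?_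
      rw [map_sub, θ.involutive, neg_one_smul, neg_sub]
    have h3 := m.smul_mem (1 / 2 : ℝ) (m.add_mem h1 h2)
    rw [add_add_sub_cancel, ← two_smul ℝ, smul_smul] at h3
    simpa using h3
  let 𝔱 : LieSubalgebra ℝ 𝔤 :=
    { m with
      lie_mem' := fun {x y} hx hy => by
        change ⁅x, y⁆ ∈ m
        rw [hm x hx y hy]
        exact m.zero_mem }
  have habel : IsLieAbelian 𝔱 := ⟨fun x y => Subtype.ext (hm x x.2 y y.2)⟩
  refine ⟨𝔱, ⟨inferInstance, ?_⟩, hmθ, hsm⟩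
  refine le_antisymm (fun u hu => ?_) 𝔱.le_normalizer
  rw [LieSubalgebra.mem_normalizer_iff'] at hu
  -- If `u` normalizes the abelian `m`, then `[x, [x, u]] = 0`, and semisimplicity of `ad x` gives
  -- `[x, u] = 0`.
  refine hcent u fun x hx => lie_eq_zero_of_lie_lie_eq_zero θ (hm _ (hmθ x hx) x hx) ?_
  exact hm x hx _ (hu x hx)

theorem exists_isCartanSubalgebra_iff {V : Type*} [AddCommGroup V] [Module ℝ V] {φ : V →ₗ[ℝ] 𝔤}
    (hcomm : ∀ x y, ⁅φ x, φ y⁆ = 0) :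
    (∃ 𝔱 : LieSubalgebra ℝ 𝔤, 𝔱.IsCartanSubalgebra ∧ (∀ x ∈ 𝔱, θ.toEquiv x ∈ 𝔱) ∧
      ∀ x, φ x ∈ 𝔱) ↔ ∀ x y, ⁅θ.toEquiv (φ x), φ y⁆ = 0 := by
  constructor
  · rintro ⟨𝔱, h𝔱, hθ, hφ⟩ x y
    -- Positivity makes the Killing form nondegenerate, so Cartan subalgebras are abelian.
    have := θ.isKilling
    have h1 := trivial_lie_zero 𝔱 𝔱 ⟨_, hθ _ (hφ x)⟩ ⟨_, hφ y⟩
    exact congrArg Subtype.val h1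
  · intro h
    have hθθ : ∀ x y, ⁅θ.toEquiv (φ x), θ.toEquiv (φ y)⁆ = 0 := fun x y => by
      rw [← LieEquiv.map_lie, hcomm, map_zero]
    have h' : ∀ x y, ⁅φ x, θ.toEquiv (φ y)⁆ = 0 := fun x y => by rw [← lie_skew, h, neg_zero]
    set s := LinearMap.range φ ⊔ LinearMap.range ((θ.toEquiv : 𝔤 →ₗ[ℝ] 𝔤) ∘ₗ φ)
    have hs : ∀ u ∈ s, ∀ v ∈ s, ⁅u, v⁆ = 0 := by
      intro u hu v hv
      obtain ⟨_, ⟨x, rfl⟩, _, ⟨x', rfl⟩, rfl⟩ := Submodule.mem_sup.mp hu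
      obtain ⟨_, ⟨y, rfl⟩, _, ⟨y', rfl⟩, rfl⟩ := Submodule.mem_sup.mp hv
      change ⁅φ x + θ.toEquiv (φ x'), φ y + θ.toEquiv (φ y')⁆ = 0
      simp only [add_lie, lie_add, hcomm, h, h', hθθ, add_zero]
    have hsθ : ∀ u ∈ s, θ.toEquiv u ∈ s := by
      intro u hu
      obtain ⟨_, ⟨x, rfl⟩, _, ⟨x', rfl⟩, rfl⟩ := Submodule.mem_sup.mp hu
      change θ.toEquiv (φ x + θ.toEquiv (φ x')) ∈ _
      rw [map_add, θ.involutive, add_comm]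
      exact Submodule.add_mem_sup ⟨x', rfl⟩ ⟨x, rfl⟩
    obtain ⟨𝔱, h𝔱, hθ, hst⟩ := exists_isCartanSubalgebra_of_lie_eq_zero θ hs hsθ
    exact ⟨𝔱, h𝔱, hθ, fun x => hst _ (Submodule.mem_sup_left ⟨x, rfl⟩)⟩

omit [FiniteDimensional ℝ 𝔤] in
/-- An injective linear map `ℝⁿ → 𝔤` becomes isometric after a change of basis of `ℝⁿ`. -/
theorem exists_isHomothety_comp {φ : Euc n →ₗ[ℝ] 𝔤} (hφ : LinearMap.ker φ = ⊥) :
    ∃ g : Euc n ≃ₗ[ℝ] Euc n, IsHomothety θ (φ ∘ₗ (g.symm : Euc n →ₗ[ℝ] Euc n)) := by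
  let ψ : Euc n →ₗ[ℝ] FormSpace θ := (toFormSpace θ : 𝔤 →ₗ[ℝ] FormSpace θ) ∘ₗ φ
  have hψ : Function.Injective ψ := (toFormSpace θ).injective.comp (LinearMap.ker_eq_bot.mp hφ)
  let e : Euc n ≃ₗ[ℝ] LinearMap.range ψ := LinearEquiv.ofInjective ψ hψ
  have hdim : Module.finrank ℝ (LinearMap.range ψ) = n := by
    rw [← e.finrank_eq, finrank_euclideanSpace_fin]
  let b := (stdOrthonormalBasis ℝ (LinearMap.range ψ)).reindex (finCongr hdim)
  -- `g` takes `x` to the coordinates of its image in an orthonormal basis of the range, hence the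
  -- factor 1.
  refine ⟨e.trans b.repr.toLinearEquiv, 1, one_pos, fun x y => ?_⟩
  have h1 : ∀ x, ψ ((e.trans b.repr.toLinearEquiv).symm x) = (b.repr.symm x : FormSpace θ) := by
    intro x
    exact congrArg Subtype.val (e.apply_symm_apply (b.repr.symm x))
  change inner ℝ (ψ ((e.trans b.repr.toLinearEquiv).symm x))
    (ψ ((e.trans b.repr.toLinearEquiv).symm y)) = _
  rw [h1, h1, ← Submodule.coe_inner, LinearIsometryEquiv.inner_map_map, one_mul]

omit [FiniteDimensional ℝ 𝔤] in
variable {θ} in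
theorem IsHomothety.ker_eq_bot {φ : Euc n →ₗ[ℝ] 𝔤} (h : IsHomothety θ φ) :
    LinearMap.ker φ = ⊥ := by
  obtain ⟨c, hc, h⟩ := h
  rw [LinearMap.ker_eq_bot']
  intro x hx
  have h1 := h x x
  rw [hx, map_zero] at h1
  exact inner_self_eq_zero.mp ((mul_eq_zero.mp h1.symm).resolve_left hc.ne')

omit [FiniteDimensional ℝ 𝔤] in
theorem act_mk_zero (g : Euc n ≃ₗ[ℝ] Euc n) (f : 𝔤 ≃ₗ[ℝ] 𝔤) (φ : Euc n →ₗ[ℝ] 𝔤) :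
    act g f ((0, φ) : Rep 𝔤 n) =
      (0, (f : 𝔤 →ₗ[ℝ] 𝔤) ∘ₗ φ ∘ₗ (g.symm : Euc n →ₗ[ℝ] Euc n)) := by
  refine Prod.ext (Subtype.ext (LinearMap.ext₂ fun x y => ?_)) rfl
  change g ((0 : AltBracket n).1 (g.symm x) (g.symm y)) = 0
  simp

/-- Since `g` is onto, precomposing with its inverse leaves the image unchanged: `g` affects only
the homothety condition, and `f` alone must achieve normality. -/
theorem energy_map_eq_iff {φ : Euc n →ₗ[ℝ] 𝔤} (hφ : ((0, φ) : Rep 𝔤 n) ≠ 0)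
    (hcomm : ∀ x y, ⁅φ x, φ y⁆ = 0) (g : Euc n ≃ₗ[ℝ] Euc n) {f : 𝔤 ≃ₗ[ℝ] 𝔤}
    (hf : f ∈ innerGroup 𝔤) :
    energy θ (Projectivization.map (act g f) (act_injective g f)
      (Projectivization.mk ℝ ((0, φ) : Rep 𝔤 n) hφ)) = 1 / (n : ℝ) ↔
    IsHomothety θ (((f : 𝔤 →ₗ[ℝ] 𝔤) ∘ₗ φ) ∘ₗ (g.symm : Euc n →ₗ[ℝ] Euc n)) ∧
      ∀ x y, ⁅θ.toEquiv (f (φ x)), f (φ y)⁆ = 0 := by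
  have hne : act g f ((0, φ) : Rep 𝔤 n) ≠ 0 :=
    (map_ne_zero_iff _ (act_injective g f)).mpr hφ
  rw [Projectivization.map_mk, energy_mk]
  rw [act_mk_zero] at hne ⊢
  rw [vecEnergy_eq_iff_of_lie_eq_zero θ hne]
  · refine and_congr Iff.rfl ⟨fun h x y => ?_, fun h x y => h _ _⟩
    simpa using h (g x) (g y)
  · intro x y
    change ⁅f (φ (g.symm x)), f (φ (g.symm y))⁆ = 0
    rw [← map_lie_of_mem_innerGroup θ hf, hcomm, map_zero]

include θ in
theorem isSemisimple_ad_map_iff {f : 𝔤 ≃ₗ[ℝ] 𝔤} (hf : f ∈ innerGroup 𝔤) (x : 𝔤) :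
    (LieAlgebra.ad ℝ 𝔤 x).IsSemisimple ↔ (LieAlgebra.ad ℝ 𝔤 (f x)).IsSemisimple :=
  LinearEquiv.isSemisimple_iff _ _ f
    (LinearMap.ext fun y => map_lie_of_mem_innerGroup θ hf x y)

end Main

end LiePair

theorem theorem3p2 {𝔤 : Type*} [LieRing 𝔤] [LieAlgebra ℝ 𝔤] [FiniteDimensional ℝ 𝔤]
    [LieAlgebra.IsSemisimple ℝ 𝔤] (θ : LiePair.CartanInvolution 𝔤) (n : ℕ)
    (φ : LiePair.Euc n →ₗ[ℝ] 𝔤) (hφ : ((0, φ) : LiePair.Rep 𝔤 n) ≠ 0)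
    (hmem : Projectivization.mk ℝ ((0, φ) : LiePair.Rep 𝔤 n) hφ ∈ LiePair.projVariety 𝔤 n) :
    (LiePair.energy θ (Projectivization.mk ℝ ((0, φ) : LiePair.Rep 𝔤 n) hφ) = 1 / (n : ℝ) ↔
      LiePair.IsHomothety θ φ ∧
        ∃ 𝔱 : LieSubalgebra ℝ 𝔤, 𝔱.IsCartanSubalgebra ∧ (∀ x ∈ 𝔱, θ.toEquiv x ∈ 𝔱) ∧
          ∀ x, φ x ∈ 𝔱) ∧
    ((∃ q ∈ LiePair.orbit (Projectivization.mk ℝ ((0, φ) : LiePair.Rep 𝔤 n) hφ),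
        LiePair.IsCritical θ q ∧ LiePair.energy θ q = 1 / (n : ℝ)) ↔
      LinearMap.ker φ = ⊥ ∧ LiePair.IsToral (LinearMap.range φ)) := by
  have hcomm := LiePair.lie_eq_zero_of_mk_mem_projVariety hφ hmem
  constructor
  · rw [LiePair.energy_mk, LiePair.vecEnergy_eq_iff_of_lie_eq_zero θ hφ hcomm,
      LiePair.exists_isCartanSubalgebra_iff θ hcomm]
  constructor
  · rintro ⟨_, ⟨g, f, hf, rfl⟩, -, hE⟩
    obtain ⟨hhom, hnormal⟩ := (LiePair.energy_map_eq_iff θ hφ hcomm g hf).mp hE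
    refine ⟨?_, ?_, ?_⟩
    · rw [LinearMap.ker_eq_bot']
      intro x hx
      have h1 := LinearMap.ker_eq_bot'.mp hhom.ker_eq_bot (g x) (by simp [hx])
      exact (map_eq_zero_iff g g.injective).mp h1
    · rintro _ ⟨x, rfl⟩ _ ⟨y, rfl⟩
      rw [hcomm]
      exact Submodule.zero_mem _
    · rintro _ ⟨x, rfl⟩
      rw [LiePair.isSemisimple_ad_map_iff θ hf]
      exact LiePair.isSemisimple_ad_of_lie_eq_zero θ (hnormal x x)
  · rintro ⟨hker, -, hss⟩
    -- `f` is chosen first, to make the image normal; `g` then corrects the metric without moving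
    -- that image.
    obtain ⟨f, hf, hnormal⟩ := LiePair.exists_mem_innerGroup_forall_lie_eq_zero θ φ
      (fun v => hss _ ⟨v, rfl⟩) hcomm
    obtain ⟨g, hg⟩ := LiePair.exists_isHomothety_comp θ (φ := (f : 𝔤 →ₗ[ℝ] 𝔤) ∘ₗ φ)
      (by rw [LinearEquiv.ker_comp, hker])
    have hE := (LiePair.energy_map_eq_iff θ hφ hcomm g hf).mpr ⟨hg, hnormal⟩
    exact ⟨_, ⟨g, f, hf, rfl⟩, LiePair.isCritical_of_energy_eq θ hE, hE⟩
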